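/- Let $d\ge 1$, let $\|\cdot\|$ be the Euclidean norm on $\mathbb R^d$, and let $K\subset\mathbb R^d$ be a convex body (a compact convex set) with non-empty interior. For $H\in(0,\tfrac12)$ let $N_H$ be a Poisson point process (identified with its counting measure) on $\mathbb R^d\times(0,\infty)$ with intensity measure $dx\,r^{-d-1+2H}\,dr$, and let $$\xi_{K,H}(z)=\int_{\mathbb R^d\times(0,\infty)}\bigl(\mathbf 1_{z\in x+rK}-\mathbf 1_{0\in x+rK}\bigr)\,N_H(dx,dr),\qquad z\in\mathbb R^d,$$ where for each $z$ the integral converges absolutely almost surely. For a unit vector $u$ let $b_K(u)$ be the $(d-1)$-dimensional volume of the orthogonal projection of $K$ onto the hyperplane $u^\perp$; let $\Pi K=\{x:\langle x,u\rangle\le b_K(u)\text{ for all unit }u\}$ be the projection body of $K$ (the convex body whose support function on the unit sphere is $b_K$), and let $\Pi^*K=\{u:\langle x,u\rangle\le 1\text{ for all }x\in\Pi K\}$ be its polar body. Put $F=\tfrac12\Pi^*K$ and let $\|u\|_F=\inf\{s\ge0:u\in sF\}$ be its Minkowski functional. Then $F$ is a star body (non-empty, closed and bounded, with $tu$ in the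 interior of $F$ for all $u\in F$ and $0\le t<1$, and with continuous Minkowski functional), the Minkowski fractional Brownian field (MfBf) $X_F$ with Hurst parameter $\tfrac12$ and associated star body $F$ exists, i.e. there is a centred Gaussian random field $X_F(z)$, $z\in\mathbb R^d$, with $$\mathbb E[X_F(z_1)X_F(z_2)]=\tfrac12\bigl(\|z_1\|_F+\|z_2\|_F-\|z_1-z_2\|_F\bigr),\qquad z_1,z_2\in\mathbb R^d,$$ and, as $H\uparrow\tfrac12$, the finite-dimensional distributions of the random field $\sqrt{1-2H}\,\xi_{K,H}(z)$, $z\in\mathbb R^d$, converge to those of $X_F(z)$, $z\in\mathbb R^d$: for all $k$ and $z_1,\dots,z_k\in\mathbb R^d$, the random vectors $\bigl(\sqrt{1-2H}\,\xi_{K,H}(z_j)\bigr)_{j=1}^k$ converge in distribution to $\bigl(X_F(z_j)\bigr)_{j=1}^k$. -/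

import Mathlib

open MeasureTheory ProbabilityTheory Filter Topology Set
open scoped Pointwise ENNReal NNReal RealInnerProductSpace

noncomputable section

/-! ### Star bodies and polar projection bodies -/

/-- A (non-empty) star body: a closed bounded set `F` such that `t • u` lies in the interior of `F`
for all `u ∈ F` and `0 ≤ t < 1`, and whose Minkowski functional is continuous. -/
structure IsStarBody {d : ℕ} (F : Set (EuclideanSpace ℝ (Fin d))) : Prop where
  nonempty : F.Nonempty
  isClosed : IsClosed F
  isBounded : Bornology.IsBounded F
  smul_mem_interior : ∀ u ∈ F, ∀ t : ℝ, 0 ≤ t → t < 1 → t • u ∈ interior F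
  continuous_gauge : Continuous (gauge F)

/-- The `(d-1)`-dimensional Lebesgue measure of the orthogonal projection of `K` onto the
hyperplane through the origin orthogonal to the (unit) vector `u`. -/
def projVol {d : ℕ} (K : Set (EuclideanSpace ℝ (Fin d))) (u : EuclideanSpace ℝ (Fin d)) : ℝ :=
  (volume : Measure ((ℝ ∙ u)ᗮ : Submodule ℝ (EuclideanSpace ℝ (Fin d)))).real
    ((ℝ ∙ u)ᗮ.orthogonalProjectionOnto '' K)

/-- The projection body of `K`: the convex set whose support function on the unit sphere is
`projVol K`. -/
def projectionBody {d : ℕ} (K : Set (EuclideanSpace ℝ (Fin d))) :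
    Set (EuclideanSpace ℝ (Fin d)) :=
  {x | ∀ u : EuclideanSpace ℝ (Fin d), ‖u‖ = 1 → ⟪x, u⟫ ≤ projVol K u}

/-- The polar set: all `u` at which the support function of `K` is at most `1`. -/
def polarSet {d : ℕ} (K : Set (EuclideanSpace ℝ (Fin d))) : Set (EuclideanSpace ℝ (Fin d)) :=
  {u | ∀ x ∈ K, ⟪x, u⟫ ≤ 1}

/-- The polar projection body of `K`. -/
def polarProjectionBody {d : ℕ} (K : Set (EuclideanSpace ℝ (Fin d))) :
    Set (EuclideanSpace ℝ (Fin d)) :=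
  polarSet (projectionBody K)

/-! ### The Minkowski fractional Brownian field -/

/-- `X` is a Minkowski fractional Brownian field on `ℝᵈ` with Hurst parameter `H ∈ (0, 1]` and
associated star body `F`: a centred Gaussian field with covariance
`(‖z₁‖_F ^ 2H + ‖z₂‖_F ^ 2H - ‖z₁ - z₂‖_F ^ 2H) / 2`. -/
structure IsMfBf {d : ℕ} {Ω : Type*} [MeasurableSpace Ω] (H : ℝ)
    (F : Set (EuclideanSpace ℝ (Fin d))) (X : EuclideanSpace ℝ (Fin d) → Ω → ℝ)
    (P : Measure Ω) : Prop where
  hurst_mem : H ∈ Ioc (0 : ℝ) 1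
  isStarBody : IsStarBody F
  isGaussian : IsGaussianProcess X P
  centred : ∀ z, ∫ ω, X z ω ∂P = 0
  covariance : ∀ z₁ z₂, ∫ ω, X z₁ ω * X z₂ ω ∂P =
    (1 / 2) * (gauge F z₁ ^ (2 * H) + gauge F z₂ ^ (2 * H) - gauge F (z₁ - z₂) ^ (2 * H))

/-! ### The fractional Poisson field -/

/-- `N` is (the random counting measure of) a Poisson point process on `S` with intensity
measure `ν`, defined on the probability space `(Ω, P)`. -/
structure IsPoissonProcess {S Ω : Type*} [MeasurableSpace S] [MeasurableSpace Ω]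
    (N : Ω → Measure S) (ν : Measure S) (P : Measure Ω) : Prop where
  measurable : Measurable N
  counting : ∀ ω, ∀ B : Set S, MeasurableSet B → ∃ n : ℕ∞, N ω B = (n : ℝ≥0∞)
  poisson : ∀ B : Set S, MeasurableSet B → ν B < ∞ →
    P.map (fun ω => N ω B) = (poissonMeasure (ν B).toNNReal).map (Nat.cast : ℕ → ℝ≥0∞)
  indep : ∀ (n : ℕ) (B : Fin n → Set S), (∀ i, MeasurableSet (B i)) →
    Pairwise (fun i j => Disjoint (B i) (B j)) → iIndepFun (fun i ω => N ω (B i)) P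

/-- The measure `dx r^{-d-1+2H} dr` on `ℝᵈ × (0, ∞)`. -/
def intensity (d : ℕ) (H : ℝ) : Measure (EuclideanSpace ℝ (Fin d) × Ioi (0 : ℝ)) :=
  (volume : Measure (EuclideanSpace ℝ (Fin d))).prod
    ((Measure.comap Subtype.val (volume : Measure ℝ)).withDensity
      fun r => ENNReal.ofReal ((r : ℝ) ^ (-(d : ℝ) - 1 + 2 * H)))

/-- The function `(x, r) ↦ 1{z ∈ x + rK} - 1{0 ∈ x + rK}`. -/
def fieldKernel {d : ℕ} (K : Set (EuclideanSpace ℝ (Fin d))) (z : EuclideanSpace ℝ (Fin d))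
    (p : EuclideanSpace ℝ (Fin d) × Ioi (0 : ℝ)) : ℝ :=
  (p.1 +ᵥ (p.2 : ℝ) • K).indicator 1 z - (p.1 +ᵥ (p.2 : ℝ) • K).indicator 1 0

/-- The fractional Poisson field with shape parameter `K` generated by the random measure `N`:
the integral of `fieldKernel K z` with respect to `N`. -/
def poissonField {d : ℕ} {Ω : Type*} (K : Set (EuclideanSpace ℝ (Fin d)))
    (N : Ω → Measure (EuclideanSpace ℝ (Fin d) × Ioi (0 : ℝ))) (z : EuclideanSpace ℝ (Fin d))
    (ω : Ω) : ℝ :=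
  ∫ p, fieldKernel K z p ∂(N ω)

end

/-! ### The covariogram of a convex body in direction `u` -/

section Fubini

variable {d : ℕ}

/-! Write A_z for the set of grains (x, r) covering z (`coverSet`). The kernel of the field is
1_{A_z} - 1_{A_0}, so a finite linear combination of kernels is a simple function g. Counts on
disjoint sets being independent and Poisson, the integral of s g has characteristic function exp ∫
(exp(i s g) - 1) dν (`IsPoissonProcess.charFun_integral`). Translation invariance in x gives ∫ g dν
= 0, and with s² = 1 - 2H the cubic Taylor remainder is at most |s| sup|g| · s² ∫ g² dν. Hence the
limit is Gaussian as soon as (1 - 2H) ∫ g² dν converges (`tendsto_exp_integral_exp_sub_one`).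

By polarization the second moments reduce to ν(A_z Δ A_w), which by scaling equals ∫ r^(2H-1)
V((z-w)/r) dr with V(w) = vol(K Δ (w+K)) (`symmDiffVol`). Slicing K by lines parallel to v, a small
shift along v removes from almost every chord a piece of the length of the shift, so V(tv)/t tends
to twice ‖v‖ times the projection volume of K along v, that is to `projNorm K v`. Thus r V(v/r) →
`projNorm K v` as r → ∞, and the integral grows like `projNorm K v` / (1 - 2H)
(`tendsto_one_sub_mul_integral_rpow_mul`).

V is subadditive, so its derivative `projNorm` at 0 is a norm. It is twice the support function of
the projection body, and a Hahn–Banach argument identifies its unit ball with half the polar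
projection body. The limiting covariance is a limit of positive semidefinite kernels, hence positive
semidefinite; a Gram representation followed by an isonormal process then realizes the Gaussian
field. -/

theorem measurePreserving_smul_add_orthogonal {u : EuclideanSpace ℝ (Fin d)} (hu : ‖u‖ = 1) :
    MeasurePreserving (fun q : ℝ × ((ℝ ∙ u)ᗮ : Submodule ℝ (EuclideanSpace ℝ (Fin d))) =>
      q.1 • u + (q.2 : EuclideanSpace ℝ (Fin d))) volume volume := by
  have h1 : MeasurePreserving (LinearIsometryEquiv.toSpanUnitSingleton (𝕜 := ℝ) u hu) volume
      volume := LinearIsometryEquiv.measurePreserving _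
  have h2 := h1.prod (MeasurePreserving.id
    (volume : Measure ((ℝ ∙ u)ᗮ : Submodule ℝ (EuclideanSpace ℝ (Fin d)))))
  have h3 := ((ℝ ∙ u).orthogonalDecomposition.symm.measurePreserving).comp
    ((WithLp.volume_preserving_toLp (ℝ ∙ u) (ℝ ∙ u)ᗮ).comp h2)
  have h4 : (fun q : ℝ × ((ℝ ∙ u)ᗮ : Submodule ℝ (EuclideanSpace ℝ (Fin d))) =>
      q.1 • u + (q.2 : EuclideanSpace ℝ (Fin d))) = (ℝ ∙ u).orthogonalDecomposition.symm ∘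
      WithLp.toLp 2 ∘ Prod.map (LinearIsometryEquiv.toSpanUnitSingleton (𝕜 := ℝ) u hu) id := by
    ext1 q
    simp
  rw [h4]
  exact h3

theorem volume_eq_lintegral_fiber {u : EuclideanSpace ℝ (Fin d)} (hu : ‖u‖ = 1)
    {A : Set (EuclideanSpace ℝ (Fin d))} (hA : MeasurableSet A) :
    volume A = ∫⁻ y : ((ℝ ∙ u)ᗮ : Submodule ℝ (EuclideanSpace ℝ (Fin d))),
      volume {s : ℝ | s • u + (y : EuclideanSpace ℝ (Fin d)) ∈ A} := by
  have h := measurePreserving_smul_add_orthogonal hu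
  rw [← h.measure_preimage hA.nullMeasurableSet, Measure.volume_eq_prod,
    Measure.prod_apply_symm (h.measurable hA)]
  rfl

end Fubini

theorem volume_Icc_diff_vadd {a b t : ℝ} (ht : 0 ≤ t) (hab : t ≤ b - a) :
    volume (Icc a b \ (t +ᵥ Icc a b)) = ENNReal.ofReal t := by
  have : Icc a b \ (t +ᵥ Icc a b) = Ico a (a + t) := by
    ext x
    simp only [Set.mem_sdiff, mem_Icc, mem_vadd_set, vadd_eq_add, mem_Ico]
    constructor
    · rintro ⟨⟨h1, h2⟩, h3⟩
      refine ⟨h1, ?_⟩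
      by_contra! h
      exact h3 ⟨x - t, ⟨by linarith, by linarith⟩, by simp⟩
    · rintro ⟨h1, h2⟩
      refine ⟨⟨h1, by linarith⟩, ?_⟩
      rintro ⟨y, ⟨h3, h4⟩, rfl⟩
      change t + y < a + t at h2
      linarith
  rw [this, Real.volume_Ico]
  congr 1; ring

/-- No restriction on the shift here: the exact value is needed only for small shifts, to find the
limit, whereas this bound provides the dominating function. -/
theorem volume_Icc_diff_vadd_le {a b t : ℝ} (ht : 0 ≤ t) :
    volume (Icc a b \ (t +ᵥ Icc a b)) ≤ ENNReal.ofReal t := by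
  have : Icc a b \ (t +ᵥ Icc a b) ⊆ Ico a (a + t) := by
    intro x
    simp only [Set.mem_sdiff, mem_Icc, mem_vadd_set, vadd_eq_add, mem_Ico]
    rintro ⟨⟨h1, h2⟩, h3⟩
    refine ⟨h1, ?_⟩
    by_contra! h
    exact h3 ⟨x - t, ⟨by linarith, by linarith⟩, by simp⟩
  refine (measure_mono this).trans ?_
  rw [Real.volume_Ico]
  simp

theorem IsCompact.exists_eq_Icc_of_convex {I : Set ℝ} (hI : IsCompact I) (hc : Convex ℝ I)
    (hne : I.Nonempty) : ∃ a b, a ≤ b ∧ I = Icc a b := by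
  have h := eq_Icc_of_connected_compact (hc.isConnected hne) hI
  exact ⟨_, _, (nonempty_Icc.1 (h ▸ hne)), h⟩

theorem volume_diff_vadd_le_of_convex {I : Set ℝ} (hI : IsCompact I) (hc : Convex ℝ I) {t : ℝ}
    (ht : 0 ≤ t) : volume (I \ (t +ᵥ I)) ≤ ENNReal.ofReal t := by
  rcases I.eq_empty_or_nonempty with rfl | hne
  · simp
  · obtain ⟨a, b, -, rfl⟩ := hI.exists_eq_Icc_of_convex hc hne
    exact volume_Icc_diff_vadd_le ht

theorem eventually_volume_diff_vadd_eq_of_convex {I : Set ℝ} (hI : IsCompact I) (hc : Convex ℝ I)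
    (hne : (interior I).Nonempty) :
    ∀ᶠ t in 𝓝[>] (0 : ℝ), volume (I \ (t +ᵥ I)) = ENNReal.ofReal t := by
  obtain ⟨a, b, -, rfl⟩ := hI.exists_eq_Icc_of_convex hc (hne.mono interior_subset)
  rw [interior_Icc, nonempty_Ioo] at hne
  filter_upwards [Ioo_mem_nhdsGT (sub_pos.2 hne)] with t ht
  exact volume_Icc_diff_vadd ht.1.le ht.2.le

/-! ### Chords of a convex body over its projection to a hyperplane. -/

section Projection

variable {d : ℕ} {K : Set (EuclideanSpace ℝ (Fin d))} {u : EuclideanSpace ℝ (Fin d)}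

theorem orthogonalProjectionOnto_smul_add (u : EuclideanSpace ℝ (Fin d)) (s : ℝ)
    (y : ((ℝ ∙ u)ᗮ : Submodule ℝ (EuclideanSpace ℝ (Fin d)))) :
    (ℝ ∙ u)ᗮ.orthogonalProjectionOnto (s • u + (y : EuclideanSpace ℝ (Fin d))) = y := by
  rw [map_add, Submodule.orthogonalProjectionOnto_mem_subspace_eq_self]
  simp

theorem exists_smul_add_orthogonalProjectionOnto (u x : EuclideanSpace ℝ (Fin d)) :
    ∃ s : ℝ, s • u + ((ℝ ∙ u)ᗮ.orthogonalProjectionOnto x : EuclideanSpace ℝ (Fin d)) = x := by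
  have h := (ℝ ∙ u).starProjection_add_starProjection_orthogonal x
  obtain ⟨s, hs⟩ := Submodule.mem_span_singleton.1 ((ℝ ∙ u).starProjection_apply_mem x)
  exact ⟨s, by rw [hs]; exact h⟩

theorem isClosedEmbedding_smul_add (hu : u ≠ 0) (y : EuclideanSpace ℝ (Fin d)) :
    IsClosedEmbedding (fun s : ℝ => s • u + y) :=
  (Homeomorph.addRight y).isClosedEmbedding.comp (isClosedEmbedding_smul_left hu)

theorem isCompact_fiber (hK : IsCompact K) (hu : u ≠ 0) (y : EuclideanSpace ℝ (Fin d)) :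
    IsCompact {s : ℝ | s • u + y ∈ K} :=
  (isClosedEmbedding_smul_add hu y).isCompact_preimage hK

theorem convex_fiber (hK : Convex ℝ K) (y : EuclideanSpace ℝ (Fin d)) :
    Convex ℝ {s : ℝ | s • u + y ∈ K} := by
  intro s hs s' hs' a b ha hb hab
  have h := hK hs hs' ha hb hab
  simp only [mem_ofPred_eq]
  convert h using 1
  rw [smul_add, smul_add, add_smul, smul_assoc, smul_assoc]
  have : y = a • y + b • y := by rw [← add_smul, hab, one_smul]
  nth_rewrite 1 [this]
  abel

theorem fiber_diff_vadd (t : ℝ) (y : EuclideanSpace ℝ (Fin d)) :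
    {s : ℝ | s • u + y ∈ K \ (t • u +ᵥ K)} =
      {s : ℝ | s • u + y ∈ K} \ (t +ᵥ {s : ℝ | s • u + y ∈ K}) := by
  ext s
  simp only [mem_ofPred_eq, Set.mem_sdiff, mem_vadd_set_iff_neg_vadd_mem, vadd_eq_add, add_smul,
    neg_smul, add_assoc]

/-- Almost every point of the projection of a convex body lies under an interior point. -/
theorem ae_mem_image_interior_of_mem_image (hc : Convex ℝ K) (hK : (interior K).Nonempty) :
    ∀ᵐ y ∂(volume : Measure ((ℝ ∙ u)ᗮ : Submodule ℝ (EuclideanSpace ℝ (Fin d)))),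
      y ∈ (ℝ ∙ u)ᗮ.orthogonalProjectionOnto '' K →
        y ∈ (ℝ ∙ u)ᗮ.orthogonalProjectionOnto '' interior K := by
  set p := (ℝ ∙ u)ᗮ.orthogonalProjectionOnto with hp
  have hopen : IsOpenMap p := p.isOpenMap fun y => ⟨y, Submodule.orthogonalProjectionOnto_mem_subspace_eq_self y⟩
  have hco : Convex ℝ (p '' interior K) := hc.interior.is_linear_image p.isLinear
  -- The image of the interior is open and convex, so its frontier is null; the image of K lies in
  -- its closure because K lies in the closure of its interior.
  have hnull : volume (frontier (p '' interior K)) = 0 := hco.addHaar_frontier volume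
  filter_upwards [measure_eq_zero_iff_ae_notMem.1 hnull] with y hy hyK
  by_contra hyi
  refine hy ⟨?_, by rwa [(hopen _ isOpen_interior).interior_eq]⟩
  obtain ⟨x, hx, rfl⟩ := hyK
  have : x ∈ closure (interior K) := by
    rw [hc.closure_interior_eq_closure_of_nonempty_interior hK]
    exact subset_closure hx
  exact image_closure_subset_closure_image p.continuous ⟨x, this, rfl⟩

theorem fiber_interior_nonempty (hu : u ≠ 0)
    {y : ((ℝ ∙ u)ᗮ : Submodule ℝ (EuclideanSpace ℝ (Fin d)))}
    (hy : y ∈ (ℝ ∙ u)ᗮ.orthogonalProjectionOnto '' interior K) :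
    (interior {s : ℝ | s • u + (y : EuclideanSpace ℝ (Fin d)) ∈ K}).Nonempty := by
  obtain ⟨x, hx, rfl⟩ := hy
  obtain ⟨s, hs⟩ := exists_smul_add_orthogonalProjectionOnto u x
  refine ⟨s, mem_interior.2 ⟨_, fun r hr => interior_subset (s := K) hr,
    isOpen_interior.preimage (isClosedEmbedding_smul_add hu _).continuous, ?_⟩⟩
  change s • u + _ ∈ interior K
  rwa [hs]

/-- The volume of `K \ (K + t u)` is asymptotic to `t` times the volume of the projection of `K`
onto the hyperplane orthogonal to `u`. -/
theorem tendsto_volume_diff_vadd_div (hu : ‖u‖ = 1) (hKc : IsCompact K) (hc : Convex ℝ K)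
    (hK : (interior K).Nonempty) :
    Tendsto (fun t : ℝ => volume (K \ (t • u +ᵥ K)) / ENNReal.ofReal t) (𝓝[>] 0)
      (𝓝 (volume ((ℝ ∙ u)ᗮ.orthogonalProjectionOnto '' K))) := by
  have hu0 : u ≠ 0 := by rintro rfl; simp at hu
  set Q := (ℝ ∙ u)ᗮ.orthogonalProjectionOnto '' K with hQ
  have hQc : IsCompact Q := hKc.image (ContinuousLinearMap.continuous _)
  set I : ((ℝ ∙ u)ᗮ : Submodule ℝ (EuclideanSpace ℝ (Fin d))) → Set ℝ :=
    fun y => {s : ℝ | s • u + (y : EuclideanSpace ℝ (Fin d)) ∈ K} with hI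
  have hempty : ∀ y, y ∉ Q → I y = ∅ := fun y hy => by
    ext s
    simp only [hI, mem_ofPred_eq, mem_empty_iff_false, iff_false]
    exact fun h => hy ⟨_, h, orthogonalProjectionOnto_smul_add u s y⟩
  have hmeas : ∀ t : ℝ, MeasurableSet (K \ (t • u +ᵥ K)) := fun t =>
    hKc.measurableSet.diff (hKc.vadd _).measurableSet
  have hvol : ∀ t : ℝ, volume (K \ (t • u +ᵥ K)) / ENNReal.ofReal t =
      ∫⁻ y, volume (I y \ (t +ᵥ I y)) / ENNReal.ofReal t := fun t => by
    rw [volume_eq_lintegral_fiber hu (hmeas t)]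
    simp_rw [fiber_diff_vadd, div_eq_mul_inv]
    rw [lintegral_mul_const]
    have h := measurable_measure_prodMk_right (μ := (volume : Measure ℝ))
      ((measurePreserving_smul_add_orthogonal hu).measurable (hmeas t))
    simpa only [hI, ← fiber_diff_vadd] using! h
  simp_rw [hvol]
  rw [← lintegral_indicator_one hQc.measurableSet]
  -- The integrand vanishes off Q and is at most 1 on Q. Almost every point of Q lies under an
  -- interior point, so its chord is nondegenerate and the quotient is eventually equal to 1.
  refine tendsto_lintegral_filter_of_dominated_convergence (Q.indicator 1) ?_ ?_ ?_ ?_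
  · refine Eventually.of_forall fun t => Measurable.div_const ?_ _
    have h := measurable_measure_prodMk_right (μ := (volume : Measure ℝ))
      ((measurePreserving_smul_add_orthogonal hu).measurable (hmeas t))
    simpa only [hI, ← fiber_diff_vadd] using! h
  · filter_upwards [self_mem_nhdsWithin] with t ht
    refine ae_of_all _ fun y => ?_
    by_cases hy : y ∈ Q
    · rw [indicator_of_mem hy]
      refine ENNReal.div_le_of_le_mul ?_
      rw [Pi.one_apply, one_mul]
      exact volume_diff_vadd_le_of_convex (isCompact_fiber hKc hu0 _) (convex_fiber hc _)
        (le_of_lt ht)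
    · simp [hempty y hy]
  · rw [lintegral_indicator_one hQc.measurableSet]
    exact hQc.measure_lt_top.ne
  · filter_upwards [ae_mem_image_interior_of_mem_image (u := u) hc hK] with y hy
    by_cases hyQ : y ∈ Q
    · rw [indicator_of_mem hyQ]
      refine tendsto_const_nhds.congr' ?_
      filter_upwards [self_mem_nhdsWithin, eventually_volume_diff_vadd_eq_of_convex
        (isCompact_fiber hKc hu0 _) (convex_fiber hc _) (fiber_interior_nonempty hu0 (hy hyQ))]
        with t ht h
      simp only [hI, h, Pi.one_apply]
      exact (ENNReal.div_self (by simpa using ht) ENNReal.ofReal_ne_top).symm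
    · simp [hempty y hyQ, indicator_of_notMem hyQ]

theorem projVol_pos (hKc : IsCompact K) (hK : (interior K).Nonempty) :
    0 < projVol K u := by
  have hopen : IsOpenMap (ℝ ∙ u)ᗮ.orthogonalProjectionOnto :=
    ContinuousLinearMap.isOpenMap _ fun y =>
      ⟨y, Submodule.orthogonalProjectionOnto_mem_subspace_eq_self y⟩
  refine ENNReal.toReal_pos ?_ (hKc.image (ContinuousLinearMap.continuous _)).measure_lt_top.ne
  exact (((hopen _ isOpen_interior).measure_pos volume (hK.image _)).trans_le
    (measure_mono (image_mono interior_subset))).ne'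

end Projection

noncomputable section

/-! ### The limiting norm -/

section SymmDiff

variable {d : ℕ} {K : Set (EuclideanSpace ℝ (Fin d))}

/-- The volume of the symmetric difference of `K` and its translate `w + K`. -/
def symmDiffVol (K : Set (EuclideanSpace ℝ (Fin d))) (w : EuclideanSpace ℝ (Fin d)) : ℝ :=
  volume.real (symmDiff K (w +ᵥ K))

theorem symmDiffVol_nonneg (w : EuclideanSpace ℝ (Fin d)) : 0 ≤ symmDiffVol K w :=
  measureReal_nonneg

theorem volume_symmDiff_vadd_ne_top (hK : IsCompact K) (w : EuclideanSpace ℝ (Fin d)) :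
    volume (symmDiff K (w +ᵥ K)) ≠ ∞ :=
  ((measure_mono symmDiff_subset_union).trans_lt (hK.union (hK.vadd w)).measure_lt_top).ne

theorem symmDiffVol_neg (w : EuclideanSpace ℝ (Fin d)) : symmDiffVol K (-w) = symmDiffVol K w := by
  have h : symmDiff K (w +ᵥ K) = w +ᵥ symmDiff K (-w +ᵥ K) := by
    rw [vadd_set_symmDiff, vadd_vadd, add_neg_cancel, zero_vadd, symmDiff_comm]
  rw [symmDiffVol, symmDiffVol, h, measureReal_def, measureReal_def, measure_vadd]

/-- Triangle inequality for the measure of symmetric differences through the intermediate set v + K,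
combined with translation invariance. This is the source of the triangle inequality for `projNorm`.
-/
theorem symmDiffVol_add_le (hK : IsCompact K) (v w : EuclideanSpace ℝ (Fin d)) :
    symmDiffVol K (v + w) ≤ symmDiffVol K v + symmDiffVol K w := by
  have h : volume (symmDiff (v +ᵥ K) ((v + w) +ᵥ K)) = volume (symmDiff K (w +ᵥ K)) := by
    rw [add_vadd, ← vadd_set_symmDiff, measure_vadd]
  have h1 : volume (symmDiff K ((v + w) +ᵥ K)) ≤
      volume (symmDiff K (v +ᵥ K)) + volume (symmDiff K (w +ᵥ K)) := by
    rw [← h]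
    exact measure_symmDiff_le _ _ _
  rw [symmDiffVol, symmDiffVol, symmDiffVol, measureReal_def, measureReal_def, measureReal_def,
    ← ENNReal.toReal_add (volume_symmDiff_vadd_ne_top hK v) (volume_symmDiff_vadd_ne_top hK w)]
  exact ENNReal.toReal_mono (ENNReal.add_ne_top.2 ⟨volume_symmDiff_vadd_ne_top hK v,
    volume_symmDiff_vadd_ne_top hK w⟩) h1

theorem symmDiffVol_le_two_mul (hK : IsCompact K) (w : EuclideanSpace ℝ (Fin d)) :
    symmDiffVol K w ≤ 2 * volume.real K := by
  have h : volume.real (w +ᵥ K) = volume.real K := by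
    rw [measureReal_def, measureReal_def, measure_vadd]
  calc symmDiffVol K w ≤ volume.real (K ∪ (w +ᵥ K)) :=
        measureReal_mono symmDiff_subset_union (hK.union (hK.vadd w)).measure_lt_top.ne
    _ ≤ volume.real K + volume.real (w +ᵥ K) := measureReal_union_le _ _
    _ = 2 * volume.real K := by rw [h]; ring

theorem symmDiffVol_zero : symmDiffVol K 0 = 0 := by
  simp [symmDiffVol]

theorem symmDiffVol_eq_two_mul (hK : IsCompact K) (w : EuclideanSpace ℝ (Fin d)) :
    symmDiffVol K w = 2 * volume.real (K \ (w +ᵥ K)) := by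
  have hm := hK.measurableSet
  have hm' : MeasurableSet (w +ᵥ K) := (hK.vadd w).measurableSet
  have h0 : volume.real (w +ᵥ K) = volume.real K := by
    rw [measureReal_def, measureReal_def, measure_vadd]
  have h1 := measureReal_inter_add_sdiff (μ := volume) (s := K) hm' hK.measure_lt_top.ne
  have h2 := measureReal_inter_add_sdiff (μ := volume) (s := w +ᵥ K) hm
    (hK.vadd w).measure_lt_top.ne
  rw [inter_comm] at h2
  rw [symmDiffVol, measureReal_symmDiff_eq hm hm' hK.measure_lt_top.ne
    (hK.vadd w).measure_lt_top.ne]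
  linarith

/-- Twice the `1`-homogeneous extension of `projVol K`. -/
def projNorm (K : Set (EuclideanSpace ℝ (Fin d))) (z : EuclideanSpace ℝ (Fin d)) : ℝ :=
  2 * (‖z‖ * projVol K (‖z‖⁻¹ • z))

theorem projNorm_of_norm_eq_one {z : EuclideanSpace ℝ (Fin d)} (hz : ‖z‖ = 1) :
    projNorm K z = 2 * projVol K z := by
  simp [projNorm, hz]

theorem projNorm_pos (hKc : IsCompact K) (hK : (interior K).Nonempty)
    {z : EuclideanSpace ℝ (Fin d)} (hz : z ≠ 0) : 0 < projNorm K z :=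
  mul_pos two_pos (mul_pos (norm_pos_iff.2 hz) (projVol_pos hKc hK))

theorem tendsto_symmDiffVol_div (hKc : IsCompact K) (hc : Convex ℝ K) (hK : (interior K).Nonempty)
    (z : EuclideanSpace ℝ (Fin d)) :
    Tendsto (fun t : ℝ => symmDiffVol K (t • z) / t) (𝓝[>] 0) (𝓝 (projNorm K z)) := by
  rcases eq_or_ne z 0 with rfl | hz
  · simp [symmDiffVol_zero, projNorm]
  have hz' : 0 < ‖z‖ := norm_pos_iff.2 hz
  have hu : ‖‖z‖⁻¹ • z‖ = 1 := norm_smul_inv_norm (𝕜 := ℝ) hz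
  have h := tendsto_volume_diff_vadd_div hu hKc hc hK
  have h1 := (ENNReal.tendsto_toReal
    (hKc.image (ContinuousLinearMap.continuous _)).measure_lt_top.ne).comp h
  have h2 : Tendsto (fun t : ℝ => t * ‖z‖) (𝓝[>] 0) (𝓝[>] 0) := by
    refine tendsto_nhdsWithin_iff.2 ⟨?_, ?_⟩
    · have : Tendsto (fun t : ℝ => t * ‖z‖) (𝓝 0) (𝓝 (0 * ‖z‖)) := tendsto_id.mul_const _
      rw [zero_mul] at this
      exact this.mono_left nhdsWithin_le_nhds
    · filter_upwards [self_mem_nhdsWithin] with t ht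
      exact mul_pos ht hz'
  have h3 := ((h1.comp h2).const_mul ‖z‖).const_mul 2
  refine h3.congr' ?_
  filter_upwards [self_mem_nhdsWithin] with t ht
  have ht' : 0 < t := ht
  simp only [Function.comp_apply, ENNReal.toReal_div, smul_smul]
  rw [mul_assoc t, mul_inv_cancel₀ hz'.ne', mul_one, ENNReal.toReal_ofReal (by positivity),
    symmDiffVol_eq_two_mul hKc, measureReal_def]
  field_simp

/-- Subadditivity passes from `symmDiffVol` to its one-sided derivative at 0. -/
theorem projNorm_add_le (hKc : IsCompact K) (hc : Convex ℝ K) (hK : (interior K).Nonempty)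
    (z w : EuclideanSpace ℝ (Fin d)) : projNorm K (z + w) ≤ projNorm K z + projNorm K w := by
  refine le_of_tendsto_of_tendsto (tendsto_symmDiffVol_div hKc hc hK (z + w))
    ((tendsto_symmDiffVol_div hKc hc hK z).add (tendsto_symmDiffVol_div hKc hc hK w)) ?_
  filter_upwards [self_mem_nhdsWithin] with t ht
  rw [← add_div, smul_add]
  exact div_le_div_of_nonneg_right (symmDiffVol_add_le hKc _ _) (le_of_lt ht)

theorem projNorm_neg (hKc : IsCompact K) (hc : Convex ℝ K) (hK : (interior K).Nonempty)
    (z : EuclideanSpace ℝ (Fin d)) : projNorm K (-z) = projNorm K z := by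
  refine tendsto_nhds_unique (tendsto_symmDiffVol_div hKc hc hK (-z)) ?_
  simp only [smul_neg, symmDiffVol_neg]
  exact tendsto_symmDiffVol_div hKc hc hK z

theorem projNorm_smul (hKc : IsCompact K) (hc : Convex ℝ K) (hK : (interior K).Nonempty)
    (a : ℝ) (z : EuclideanSpace ℝ (Fin d)) : projNorm K (a • z) = ‖a‖ * projNorm K z := by
  have key : ∀ a : ℝ, 0 < a → projNorm K (a • z) = a * projNorm K z := fun a ha => by
    rw [projNorm, projNorm, norm_smul, smul_smul, Real.norm_of_nonneg ha.le, mul_inv, mul_comm a⁻¹,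
      mul_assoc ‖z‖⁻¹, inv_mul_cancel₀ ha.ne', mul_one]
    ring
  rcases lt_trichotomy a 0 with ha | rfl | ha
  · have := key (-a) (neg_pos.2 ha)
    rw [neg_smul, projNorm_neg hKc hc hK] at this
    rw [this, Real.norm_of_nonpos ha.le]
  · simp [projNorm]
  · rw [key a ha, Real.norm_of_nonneg ha.le]

/-- `projNorm K` as a seminorm. -/
def projSeminorm (hKc : IsCompact K) (hc : Convex ℝ K) (hK : (interior K).Nonempty) :
    Seminorm ℝ (EuclideanSpace ℝ (Fin d)) :=
  Seminorm.of (projNorm K) (projNorm_add_le hKc hc hK) (projNorm_smul hKc hc hK)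

theorem projSeminorm_apply (hKc : IsCompact K) (hc : Convex ℝ K) (hK : (interior K).Nonempty)
    (z : EuclideanSpace ℝ (Fin d)) : projSeminorm hKc hc hK z = projNorm K z := rfl

theorem symmDiffVol_nsmul_le (hKc : IsCompact K) (w : EuclideanSpace ℝ (Fin d)) (n : ℕ) :
    symmDiffVol K ((n : ℝ) • w) ≤ n * symmDiffVol K w := by
  induction n with
  | zero => simp [symmDiffVol_zero]
  | succ n ih =>
    push_cast
    rw [add_smul, one_smul, add_mul, one_mul]
    exact (symmDiffVol_add_le hKc _ _).trans (by linarith)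

/-- A subadditive function satisfies V(w) ≤ n V(w/n), and the right side tends to the derivative.
The bound is global in w, so it controls r V(v/r) for all r > 0 at once. -/
theorem symmDiffVol_le_projNorm (hKc : IsCompact K) (hc : Convex ℝ K) (hK : (interior K).Nonempty)
    (w : EuclideanSpace ℝ (Fin d)) : symmDiffVol K w ≤ projNorm K w := by
  have h1 : Tendsto (fun n : ℕ => ((n : ℝ) + 1)⁻¹) atTop (𝓝[>] 0) := by
    refine tendsto_nhdsWithin_iff.2 ⟨?_, Eventually.of_forall fun n => ?_⟩
    · simpa only [one_div] using tendsto_one_div_add_atTop_nhds_zero_nat (𝕜 := ℝ)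
    · exact inv_pos.2 (by positivity : (0 : ℝ) < n + 1)
  refine ge_of_tendsto ((tendsto_symmDiffVol_div hKc hc hK w).comp h1)
    (Eventually.of_forall fun n => ?_)
  have h2 := symmDiffVol_nsmul_le hKc (((n : ℝ) + 1)⁻¹ • w) (n + 1)
  push_cast at h2
  rw [smul_smul, mul_inv_cancel₀ (by positivity), one_smul] at h2
  simp only [Function.comp_apply, div_inv_eq_mul]
  linarith

end SymmDiff

/-! ### Unit balls of norms are star bodies, and polars of Wulff shapes -/

section StarBody

variable {d : ℕ} {p : Seminorm ℝ (EuclideanSpace ℝ (Fin d))}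

theorem Seminorm.continuous_of_euclideanSpace (p : Seminorm ℝ (EuclideanSpace ℝ (Fin d))) :
    Continuous p := by
  rw [← continuousOn_univ]
  exact p.convexOn.continuousOn isOpen_univ

theorem Seminorm.gauge_closedBall_zero_one (p : Seminorm ℝ (EuclideanSpace ℝ (Fin d))) :
    gauge (p.closedBall 0 1) = p := by
  ext x
  refine le_antisymm (le_of_forall_gt_imp_ge_of_dense fun a ha => ?_) ?_
  · have ha0 : 0 < a := (apply_nonneg p x).trans_lt ha
    refine gauge_le_of_mem ha0.le ?_
    rw [mem_smul_set_iff_inv_smul_mem₀ ha0.ne', Seminorm.mem_closedBall_zero, map_smul_eq_mul,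
      norm_inv, Real.norm_of_nonneg ha0.le, inv_mul_le_iff₀ ha0, mul_one]
    exact ha.le
  · refine le_of_forall_gt_imp_ge_of_dense fun a ha => ?_
    obtain ⟨b, hb, hba, y, hy, rfl⟩ :=
      exists_lt_of_gauge_lt (p.absorbent_closedBall_zero one_pos) ha
    rw [Seminorm.mem_closedBall_zero] at hy
    simp only [map_smul_eq_mul, Real.norm_of_nonneg hb.le]
    nlinarith

theorem Seminorm.isStarBody_closedBall (hp : ∀ x, x ≠ 0 → 0 < p x) :
    IsStarBody (p.closedBall 0 1) where
  nonempty := ⟨0, by simp⟩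
  isClosed := by
    have : p.closedBall 0 1 = p ⁻¹' Iic 1 := by ext; simp
    rw [this]
    exact isClosed_Iic.preimage p.continuous_of_euclideanSpace
  isBounded := by
    -- The sphere is empty only in the trivial space. Otherwise `p` attains a positive minimum on it
    -- at some `u`, and homogeneity confines the unit ball of `p` to radius `(p u)⁻¹`.
    rcases (Metric.sphere (0 : EuclideanSpace ℝ (Fin d)) 1).eq_empty_or_nonempty with he | hne
    · have hs : Subsingleton (EuclideanSpace ℝ (Fin d)) := by
        refine ⟨fun x y => ?_⟩
        by_contra hxy
        have : ‖x - y‖⁻¹ • (x - y) ∈ Metric.sphere (0 : EuclideanSpace ℝ (Fin d)) 1 := by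
          rw [mem_sphere_zero_iff_norm]
          exact norm_smul_inv_norm (𝕜 := ℝ) (sub_ne_zero.2 hxy)
        rw [he] at this
        exact this
      exact (Set.toFinite _).isBounded
    · obtain ⟨u, hu, hmin⟩ := (isCompact_sphere (0 : EuclideanSpace ℝ (Fin d)) 1).exists_isMinOn
        hne p.continuous_of_euclideanSpace.continuousOn
      have hu0 : u ≠ 0 := by rintro rfl; simp at hu
      refine (Metric.isBounded_closedBall (x := (0 : EuclideanSpace ℝ (Fin d)))
        (r := (p u)⁻¹)).subset fun x hx => ?_
      rw [Seminorm.mem_closedBall_zero] at hx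
      rw [mem_closedBall_zero_iff]
      rcases eq_or_ne x 0 with rfl | hx0
      · simp
      have h1 : p u ≤ p (‖x‖⁻¹ • x) := hmin (by
        rw [mem_sphere_zero_iff_norm]
        exact norm_smul_inv_norm (𝕜 := ℝ) hx0)
      rw [map_smul_eq_mul, norm_inv, norm_norm, le_inv_mul_iff₀ (norm_pos_iff.2 hx0)] at h1
      rw [← one_div, le_div_iff₀ (hp u hu0)]
      exact h1.trans hx
  smul_mem_interior := by
    intro u hu t ht0 ht1
    have hsub : p ⁻¹' Iio 1 ⊆ p.closedBall 0 1 := fun x hx => by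
      rw [Seminorm.mem_closedBall_zero]
      exact le_of_lt hx
    refine mem_interior.2 ⟨_, hsub, isOpen_Iio.preimage p.continuous_of_euclideanSpace, ?_⟩
    rw [Seminorm.mem_closedBall_zero] at hu
    rw [mem_preimage, mem_Iio, map_smul_eq_mul, Real.norm_of_nonneg ht0]
    nlinarith [apply_nonneg p u]
  continuous_gauge := by
    rw [p.gauge_closedBall_zero_one]
    exact p.continuous_of_euclideanSpace

/-- Hahn–Banach: the functional c u ↦ c p(u) on the line through u is dominated by p and extends
with the same domination; x is its Riesz representative. -/
theorem Seminorm.exists_inner_le_and_eq (p : Seminorm ℝ (EuclideanSpace ℝ (Fin d)))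
    (u : EuclideanSpace ℝ (Fin d)) :
    ∃ x : EuclideanSpace ℝ (Fin d), (∀ v, ⟪x, v⟫ ≤ p v) ∧ ⟪x, u⟫ = p u := by
  rcases eq_or_ne u 0 with rfl | hu
  · exact ⟨0, fun v => by simp, by simp⟩
  obtain ⟨g, hg1, hg2⟩ := exists_extension_of_le_sublinear (LinearPMap.mkSpanSingleton u (p u) hu)
    p (fun c hc x => by rw [map_smul_eq_mul, Real.norm_of_nonneg hc.le]) (map_add_le_add p)
    (by
      rintro ⟨x, hx⟩
      obtain ⟨c, rfl⟩ := Submodule.mem_span_singleton.1 hx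
      refine (LinearPMap.mkSpanSingleton'_apply u (p u) _ c hx).trans_le ?_
      simp only [RingHom.id_apply, smul_eq_mul, map_smul_eq_mul]
      exact mul_le_mul_of_nonneg_right (le_abs_self c) (apply_nonneg p u))
  refine ⟨(InnerProductSpace.toDual ℝ _).symm (LinearMap.toContinuousLinearMap g), fun v => ?_, ?_⟩
  · rw [InnerProductSpace.toDual_symm_apply]
    exact hg2 v
  · rw [InnerProductSpace.toDual_symm_apply]
    have := hg1 ⟨u, Submodule.mem_span_singleton_self u⟩
    rw [LinearPMap.mkSpanSingleton_apply] at this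
    exact this

/-- The support function of the Wulff shape of a norm is that norm. -/
theorem Seminorm.polarSet_eq_closedBall (p : Seminorm ℝ (EuclideanSpace ℝ (Fin d))) :
    polarSet {x | ∀ u : EuclideanSpace ℝ (Fin d), ‖u‖ = 1 → ⟪x, u⟫ ≤ p u} = p.closedBall 0 1 := by
  ext u
  rw [Seminorm.mem_closedBall_zero]
  constructor
  · intro h
    obtain ⟨x, hx, hxu⟩ := p.exists_inner_le_and_eq u
    rw [← hxu]
    exact h x fun v _ => hx v
  · intro h x hx
    rcases eq_or_ne u 0 with rfl | hu
    · simp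
    have h1 := hx (‖u‖⁻¹ • u) (norm_smul_inv_norm (𝕜 := ℝ) hu)
    rw [inner_smul_right, map_smul_eq_mul, norm_inv, norm_norm] at h1
    exact (le_of_mul_le_mul_left h1 (inv_pos.2 (norm_pos_iff.2 hu))).trans h

end StarBody

section PolarProjectionBody

variable {d : ℕ} {K : Set (EuclideanSpace ℝ (Fin d))}

/-- Half of `projSeminorm` agrees with `projVol K` on unit vectors, so `projectionBody K` is its
Wulff shape and the polar is its unit ball. The dilation by 1/2 restores the factor 2 in `projNorm`.
-/
theorem half_smul_polarProjectionBody_eq (hKc : IsCompact K) (hc : Convex ℝ K)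
    (hK : (interior K).Nonempty) :
    (1 / 2 : ℝ) • polarProjectionBody K = (projSeminorm hKc hc hK).closedBall 0 1 := by
  have h1 : projectionBody K = {x | ∀ u : EuclideanSpace ℝ (Fin d), ‖u‖ = 1 →
      ⟪x, u⟫ ≤ ((1 / 2 : ℝ≥0) • projSeminorm hKc hc hK) u} := by
    ext x
    refine forall₂_congr fun u hu => ?_
    rw [_root_.smul_apply, projSeminorm_apply, projNorm_of_norm_eq_one hu, NNReal.smul_def]
    simp
  rw [polarProjectionBody, h1, Seminorm.polarSet_eq_closedBall]
  ext u
  rw [mem_smul_set_iff_inv_smul_mem₀ (by norm_num), Seminorm.mem_closedBall_zero,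
    Seminorm.mem_closedBall_zero, _root_.smul_apply, map_smul_eq_mul, NNReal.smul_def]
  simp

theorem gauge_half_smul_polarProjectionBody (hKc : IsCompact K) (hc : Convex ℝ K)
    (hK : (interior K).Nonempty) (z : EuclideanSpace ℝ (Fin d)) :
    gauge ((1 / 2 : ℝ) • polarProjectionBody K) z = projNorm K z := by
  rw [half_smul_polarProjectionBody_eq hKc hc hK, Seminorm.gauge_closedBall_zero_one,
    projSeminorm_apply]

theorem isStarBody_half_smul_polarProjectionBody (hKc : IsCompact K) (hc : Convex ℝ K)
    (hK : (interior K).Nonempty) : IsStarBody ((1 / 2 : ℝ) • polarProjectionBody K) := by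
  rw [half_smul_polarProjectionBody_eq hKc hc hK]
  exact Seminorm.isStarBody_closedBall fun x hx => projNorm_pos hKc hK hx

end PolarProjectionBody

end

/-! ### An Abelian theorem for integrals against `r ^ (a - 1)` as `a ↑ 1` -/

section Abelian

variable {ψ : ℝ → ℝ} {C C' L a : ℝ}

theorem integrableOn_rpow_mul_Ioc (hψ : Measurable ψ) (h0 : ∀ r, 0 ≤ ψ r) (hC : ∀ r, ψ r ≤ C)
    (ha : 0 < a) {R : ℝ} : IntegrableOn (fun r => r ^ (a - 1) * ψ r) (Ioc 0 R) := by
  have h := (intervalIntegral.intervalIntegrable_rpow' (a := 0) (b := R)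
    (by linarith : -1 < a - 1)).1.mul_const C
  refine Integrable.mono' h (by fun_prop) ?_
  filter_upwards [ae_restrict_mem measurableSet_Ioc] with r hr
  have hr0 : 0 ≤ r ^ (a - 1) := Real.rpow_nonneg hr.1.le _
  rw [Real.norm_of_nonneg (mul_nonneg hr0 (h0 r))]
  exact mul_le_mul_of_nonneg_left (hC r) hr0

theorem rpow_mul_eq_rpow_mul_mul {r : ℝ} (hr : 0 < r) (y : ℝ) :
    r ^ (a - 1) * y = r ^ (a - 2) * (r * y) := by
  rw [← mul_assoc, ← Real.rpow_add_one hr.ne']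
  congr 2; ring

theorem integrableOn_rpow_mul_Ioi (hψ : Measurable ψ) (h0 : ∀ r, 0 ≤ ψ r)
    (hC' : ∀ r, 0 < r → r * ψ r ≤ C') (ha : a < 1) {R : ℝ} (hR : 0 < R) :
    IntegrableOn (fun r => r ^ (a - 1) * ψ r) (Ioi R) := by
  have h := (integrableOn_Ioi_rpow_of_lt (by linarith : a - 2 < -1) hR).mul_const C'
  refine Integrable.mono' h (by fun_prop) ?_
  filter_upwards [ae_restrict_mem measurableSet_Ioi] with r hr
  have hr0 : 0 < r := hR.trans hr
  rw [Real.norm_of_nonneg (mul_nonneg (Real.rpow_nonneg hr0.le _) (h0 r)),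
    rpow_mul_eq_rpow_mul_mul hr0]
  exact mul_le_mul_of_nonneg_left (hC' r hr0) (Real.rpow_nonneg hr0.le _)

/-- The bound `C` on ψ settles integrability at 0, where `0 < a` is used; the bound `C'` on r ψ(r)
settles it at infinity, where `a < 1` is used. -/
theorem integrableOn_rpow_mul (hψ : Measurable ψ) (h0 : ∀ r, 0 ≤ ψ r) (hC : ∀ r, ψ r ≤ C)
    (hC' : ∀ r, 0 < r → r * ψ r ≤ C') (ha0 : 0 < a) (ha : a < 1) :
    IntegrableOn (fun r => r ^ (a - 1) * ψ r) (Ioi 0) := by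
  rw [← Ioc_union_Ioi_eq_Ioi zero_le_one]
  exact (integrableOn_rpow_mul_Ioc hψ h0 hC ha0).union
    (integrableOn_rpow_mul_Ioi hψ h0 hC' ha one_pos)

theorem one_sub_mul_setIntegral_Ioi_rpow (ha : a < 1) {R : ℝ} (hR : 0 < R) :
    (1 - a) * ∫ r in Ioi R, r ^ (a - 2) = R ^ (a - 1) := by
  rw [integral_Ioi_rpow_of_lt (by linarith) hR, show a - 2 + 1 = a - 1 by ring]
  have : a - 1 ≠ 0 := by linarith
  field_simp
  ring

/-- Beyond a large R the integrand is close to L r^(a-2), whose integral is L R^(a-1) / (1-a), and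
R^(a-1) → 1. The part over (0, R] stays bounded as a ↑ 1 and is killed by the factor 1 - a. -/
theorem tendsto_one_sub_mul_integral_rpow_mul (hψ : Measurable ψ) (h0 : ∀ r, 0 ≤ ψ r)
    (hC : ∀ r, ψ r ≤ C) (hC' : ∀ r, 0 < r → r * ψ r ≤ C')
    (hL : Tendsto (fun r => r * ψ r) atTop (𝓝 L)) :
    Tendsto (fun a : ℝ => (1 - a) * ∫ r in Ioi 0, r ^ (a - 1) * ψ r) (𝓝[<] 1) (𝓝 L) := by
  have key : ∀ ε > 0, ∃ R : ℝ, 0 < R ∧ ∀ a, 0 < a → a < 1 →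
      (L - ε) * R ^ (a - 1) ≤ (1 - a) * ∫ r in Ioi 0, r ^ (a - 1) * ψ r ∧
      (1 - a) * ∫ r in Ioi 0, r ^ (a - 1) * ψ r ≤
        (1 - a) * (R ^ a / a * C) + (L + ε) * R ^ (a - 1) := by
    intro ε hε
    obtain ⟨R₀, hR₀⟩ := eventually_atTop.1 (hL.eventually (Icc_mem_nhds (sub_lt_self L hε)
      (lt_add_of_pos_right L hε)))
    -- The maximum with 1 only keeps R positive. R depends on ε but not on a, so a ↑ 1 can be taken
    -- with R fixed.
    refine ⟨max R₀ 1, by positivity, fun a ha0 ha => ?_⟩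
    set R := max R₀ 1
    have hR : 0 < R := by positivity
    have hbd : ∀ r ∈ Ioi R, L - ε ≤ r * ψ r ∧ r * ψ r ≤ L + ε := fun r hr =>
      hR₀ r ((le_max_left _ _).trans (le_of_lt hr))
    have hi1 := integrableOn_rpow_mul_Ioc (R := R) hψ h0 hC ha0
    have hi2 := integrableOn_rpow_mul_Ioi hψ h0 hC' ha hR
    have hi3 := integrableOn_Ioi_rpow_of_lt (by linarith : a - 2 < -1) hR
    have hsplit : ∫ r in Ioi 0, r ^ (a - 1) * ψ r =
        (∫ r in Ioc 0 R, r ^ (a - 1) * ψ r) + ∫ r in Ioi R, r ^ (a - 1) * ψ r := by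
      rw [← setIntegral_union Ioc_disjoint_Ioi_same measurableSet_Ioi hi1 hi2,
        Ioc_union_Ioi_eq_Ioi hR.le]
    have h1 : 0 ≤ ∫ r in Ioc 0 R, r ^ (a - 1) * ψ r :=
      setIntegral_nonneg measurableSet_Ioc fun r hr =>
        mul_nonneg (Real.rpow_nonneg hr.1.le _) (h0 r)
    have h2 : ∫ r in Ioc 0 R, r ^ (a - 1) * ψ r ≤ R ^ a / a * C := by
      have hi : IntegrableOn (fun r : ℝ => r ^ (a - 1)) (Ioc 0 R) :=
        (intervalIntegral.intervalIntegrable_rpow' (by linarith : -1 < a - 1)).1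
      calc ∫ r in Ioc 0 R, r ^ (a - 1) * ψ r ≤ ∫ r in Ioc 0 R, r ^ (a - 1) * C :=
            setIntegral_mono_on hi1 (hi.mul_const C) measurableSet_Ioc fun r hr =>
              mul_le_mul_of_nonneg_left (hC r) (Real.rpow_nonneg hr.1.le _)
        _ = R ^ a / a * C := by
            rw [integral_mul_const, ← intervalIntegral.integral_of_le hR.le,
              integral_rpow (Or.inl (by linarith)), sub_add_cancel, Real.zero_rpow ha0.ne',
              sub_zero]
    have h3 : (L - ε) * R ^ (a - 1) ≤ (1 - a) * ∫ r in Ioi R, r ^ (a - 1) * ψ r := by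
      rw [← one_sub_mul_setIntegral_Ioi_rpow ha hR, mul_left_comm, ← integral_const_mul]
      refine mul_le_mul_of_nonneg_left ?_ (by linarith)
      refine setIntegral_mono_on (hi3.const_mul _) hi2 measurableSet_Ioi fun r hr => ?_
      rw [rpow_mul_eq_rpow_mul_mul (hR.trans hr), mul_comm]
      exact mul_le_mul_of_nonneg_left (hbd r hr).1 (Real.rpow_nonneg (hR.trans hr).le _)
    have h4 : (1 - a) * ∫ r in Ioi R, r ^ (a - 1) * ψ r ≤ (L + ε) * R ^ (a - 1) := by
      rw [← one_sub_mul_setIntegral_Ioi_rpow ha hR, mul_left_comm (L + ε),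
        ← integral_const_mul (L + ε)]
      refine mul_le_mul_of_nonneg_left ?_ (by linarith)
      refine setIntegral_mono_on hi2 (hi3.const_mul _) measurableSet_Ioi fun r hr => ?_
      rw [rpow_mul_eq_rpow_mul_mul (hR.trans hr), mul_comm (L + ε)]
      exact mul_le_mul_of_nonneg_left (hbd r hr).2 (Real.rpow_nonneg (hR.trans hr).le _)
    have ha1 : 0 ≤ 1 - a := by linarith
    rw [hsplit, mul_add]
    exact ⟨h3.trans (le_add_of_nonneg_left (mul_nonneg ha1 h1)),
      add_le_add (mul_le_mul_of_nonneg_left h2 ha1) h4⟩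
  have hev : ∀ᶠ a : ℝ in 𝓝[<] 1, 0 < a ∧ a < 1 := Ioo_mem_nhdsLT zero_lt_one
  refine (tendsto_order.2 ⟨fun b hb => ?_, fun b hb => ?_⟩)
  · obtain ⟨R, hR, h⟩ := key ((L - b) / 2) (by linarith)
    have hcont : ContinuousAt (fun a : ℝ => (L - (L - b) / 2) * R ^ (a - 1)) 1 := by
      fun_prop (disch := positivity)
    have hlim : Tendsto (fun a : ℝ => (L - (L - b) / 2) * R ^ (a - 1)) (𝓝[<] 1)
        (𝓝 (L - (L - b) / 2)) := by
      simpa using hcont.tendsto.mono_left nhdsWithin_le_nhds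
    filter_upwards [hev, hlim.eventually_const_lt (by linarith : b < _)] with a ha hb'
    exact hb'.trans_le (h a ha.1 ha.2).1
  · obtain ⟨R, hR, h⟩ := key ((b - L) / 2) (by linarith)
    have hcont : ContinuousAt (fun a : ℝ => (1 - a) * (R ^ a / a * C) +
        (L + (b - L) / 2) * R ^ (a - 1)) 1 := by
      fun_prop (disch := positivity)
    have hlim : Tendsto (fun a : ℝ => (1 - a) * (R ^ a / a * C) +
        (L + (b - L) / 2) * R ^ (a - 1)) (𝓝[<] 1) (𝓝 (L + (b - L) / 2)) := by
      simpa using hcont.tendsto.mono_left nhdsWithin_le_nhds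
    filter_upwards [hev, hlim.eventually_lt_const (by linarith : _ < b)] with a ha hb'
    exact (h a ha.1 ha.2).2.trans_lt hb'

end Abelian

noncomputable section

/-! ### The grains covering a point -/

section Grains

variable {d : ℕ} {K : Set (EuclideanSpace ℝ (Fin d))}

/-- The set of all `(x, r)` for which `x + r K` covers the point `z`. -/
def coverSet (K : Set (EuclideanSpace ℝ (Fin d))) (z : EuclideanSpace ℝ (Fin d)) :
    Set (EuclideanSpace ℝ (Fin d) × Ioi (0 : ℝ)) :=
  {q | z ∈ q.1 +ᵥ (q.2 : ℝ) • K}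

theorem mem_coverSet {z : EuclideanSpace ℝ (Fin d)} {q : EuclideanSpace ℝ (Fin d) × Ioi (0 : ℝ)} :
    q ∈ coverSet K z ↔ (q.2 : ℝ)⁻¹ • (z - q.1) ∈ K := by
  rw [coverSet, mem_ofPred_eq, mem_vadd_set_iff_neg_vadd_mem,
    mem_smul_set_iff_inv_smul_mem₀ (ne_of_gt q.2.2), vadd_eq_add, neg_add_eq_sub]

theorem measurableSet_coverSet (hK : IsCompact K) (z : EuclideanSpace ℝ (Fin d)) :
    MeasurableSet (coverSet K z) := by
  have h : coverSet K z = (fun q : EuclideanSpace ℝ (Fin d) × Ioi (0 : ℝ) =>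
      (q.2 : ℝ)⁻¹ • (z - q.1)) ⁻¹' K := by
    ext q
    exact mem_coverSet
  rw [h]
  exact hK.measurableSet.preimage (by fun_prop)

theorem measurable_symmDiffVol (hK : IsCompact K) : Measurable (symmDiffVol K) := by
  have hm : MeasurableSet (symmDiff {q : EuclideanSpace ℝ (Fin d) × EuclideanSpace ℝ (Fin d) |
      q.2 ∈ K} {q | -q.1 + q.2 ∈ K}) :=
    (hK.measurableSet.preimage measurable_snd).symmDiff
      (hK.measurableSet.preimage (by fun_prop : Measurable fun q : EuclideanSpace ℝ (Fin d) ×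
        EuclideanSpace ℝ (Fin d) => -q.1 + q.2))
  have h := (measurable_measure_prodMk_left (ν := volume) hm).ennreal_toReal
  convert h using 2 with w
  rw [symmDiffVol, measureReal_def]
  congr 2
  ext x
  simp [mem_symmDiff, mem_vadd_set_iff_neg_vadd_mem]

/-- The substitution x = z - r y turns the two covering conditions into y ∈ K and y ∈ (z-w)/r + K;
the dilation contributes r^d. -/
theorem volume_fiber_symmDiff_coverSet (hK : IsCompact K) (z w : EuclideanSpace ℝ (Fin d))
    (r : Ioi (0 : ℝ)) :
    volume ((fun x => (x, r)) ⁻¹' symmDiff (coverSet K z) (coverSet K w)) =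
      ENNReal.ofReal ((r : ℝ) ^ d * symmDiffVol K ((r : ℝ)⁻¹ • (z - w))) := by
  have hr : (0 : ℝ) < r := r.2
  have h : (fun x => (x, r)) ⁻¹' symmDiff (coverSet K z) (coverSet K w) =
      z +ᵥ (-(r : ℝ)) • symmDiff K ((r : ℝ)⁻¹ • (z - w) +ᵥ K) := by
    ext x
    rw [mem_vadd_set_iff_neg_vadd_mem, mem_smul_set_iff_inv_smul_mem₀ (neg_ne_zero.2 hr.ne')]
    simp only [mem_preimage, mem_symmDiff, mem_coverSet, mem_vadd_set_iff_neg_vadd_mem, vadd_eq_add]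
    have h1 : (-(r : ℝ))⁻¹ • (-z + x) = (r : ℝ)⁻¹ • (z - x) := by
      rw [inv_neg, neg_smul, ← smul_neg]
      congr 1; abel
    have h2 : -((r : ℝ)⁻¹ • (z - w)) + (r : ℝ)⁻¹ • (z - x) = (r : ℝ)⁻¹ • (w - x) := by
      rw [← smul_neg, ← smul_add]
      congr 1; abel
    rw [h1, h2]
  rw [h, measure_vadd, Measure.addHaar_smul, finrank_euclideanSpace_fin, abs_pow, abs_neg,
    abs_of_pos hr, ENNReal.ofReal_mul (by positivity), symmDiffVol, measureReal_def,
    ENNReal.ofReal_toReal (volume_symmDiff_vadd_ne_top hK _)]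

theorem intensity_apply (H : ℝ) {B : Set (EuclideanSpace ℝ (Fin d) × Ioi (0 : ℝ))}
    (hB : MeasurableSet B) :
    intensity d H B = ∫⁻ r : Ioi (0 : ℝ), ENNReal.ofReal ((r : ℝ) ^ (-(d : ℝ) - 1 + 2 * H)) *
      volume ((fun x => (x, r)) ⁻¹' B) ∂(Measure.comap Subtype.val volume) := by
  have : LocallyCompactSpace (Ioi (0 : ℝ)) := isOpen_Ioi.locallyCompactSpace
  have : IsFiniteMeasureOnCompacts
      (Measure.comap Subtype.val (volume : Measure ℝ) : Measure (Ioi (0 : ℝ))) :=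
    .comap' _ continuous_subtype_val (MeasurableEmbedding.subtype_coe measurableSet_Ioi)
  rw [intensity, Measure.prod_apply_symm hB, lintegral_withDensity_eq_lintegral_mul _ (by fun_prop)
    (measurable_measure_prodMk_right hB)]
  rfl

/-- The r^d from the dilation cancels the r^(-d) of the intensity. The remaining exponent 2H - 1 is
a - 1 with a = 2H, as in the Abelian theorem. -/
theorem intensity_symmDiff_coverSet (hK : IsCompact K) (H : ℝ) (z w : EuclideanSpace ℝ (Fin d)) :
    intensity d H (symmDiff (coverSet K z) (coverSet K w)) =
      ∫⁻ r in Ioi (0 : ℝ),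
        ENNReal.ofReal (r ^ (2 * H - 1) * symmDiffVol K (r⁻¹ • (z - w))) := by
  rw [intensity_apply H ((measurableSet_coverSet hK z).symmDiff (measurableSet_coverSet hK w)),
    ← lintegral_subtype_comap measurableSet_Ioi]
  refine lintegral_congr fun r => ?_
  have hr : (0 : ℝ) < r := r.2
  rw [volume_fiber_symmDiff_coverSet hK, ← ENNReal.ofReal_mul (Real.rpow_nonneg hr.le _),
    ← mul_assoc, ← Real.rpow_natCast, ← Real.rpow_add hr]
  congr 3; ring

theorem integrableOn_rpow_mul_symmDiffVol (hKc : IsCompact K) (hc : Convex ℝ K)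
    (hK : (interior K).Nonempty) (v : EuclideanSpace ℝ (Fin d)) {H : ℝ}
    (hH : H ∈ Ioo (0 : ℝ) (1 / 2)) :
    IntegrableOn (fun r : ℝ => r ^ (2 * H - 1) * symmDiffVol K (r⁻¹ • v)) (Ioi 0) :=
  integrableOn_rpow_mul (C := 2 * volume.real K) (C' := projNorm K v)
    ((measurable_symmDiffVol hKc).comp (by fun_prop)) (fun _ => symmDiffVol_nonneg _)
    (fun _ => symmDiffVol_le_two_mul hKc _)
    (fun r hr => by
      rw [← le_inv_mul_iff₀ hr]
      have h := symmDiffVol_le_projNorm hKc hc hK (r⁻¹ • v)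
      rwa [projNorm_smul hKc hc hK, Real.norm_of_nonneg (inv_nonneg.2 hr.le)] at h)
    (by linarith [hH.1]) (by linarith [hH.2])

theorem measureReal_intensity_symmDiff_coverSet (hKc : IsCompact K) (H : ℝ)
    (z w : EuclideanSpace ℝ (Fin d)) :
    (intensity d H).real (symmDiff (coverSet K z) (coverSet K w)) =
      ∫ r in Ioi (0 : ℝ), r ^ (2 * H - 1) * symmDiffVol K (r⁻¹ • (z - w)) := by
  have hm : Measurable fun r : ℝ => symmDiffVol K (r⁻¹ • (z - w)) :=
    (measurable_symmDiffVol hKc).comp (by fun_prop)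
  rw [measureReal_def, intensity_symmDiff_coverSet hKc, integral_eq_lintegral_of_nonneg_ae]
  · filter_upwards [ae_restrict_mem measurableSet_Ioi] with r hr
    exact mul_nonneg (Real.rpow_nonneg (le_of_lt hr) _) (symmDiffVol_nonneg _)
  · fun_prop

theorem intensity_symmDiff_coverSet_ne_top (hKc : IsCompact K) (hc : Convex ℝ K)
    (hK : (interior K).Nonempty) {H : ℝ} (hH : H ∈ Ioo (0 : ℝ) (1 / 2))
    (z w : EuclideanSpace ℝ (Fin d)) :
    intensity d H (symmDiff (coverSet K z) (coverSet K w)) ≠ ∞ := by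
  rw [intensity_symmDiff_coverSet hKc]
  exact (integrableOn_rpow_mul_symmDiffVol hKc hc hK (z - w) hH).lintegral_lt_top.ne

/-- The intensity of the set of grains separating `z` and `w` blows up like
`projNorm K (z - w) / (1 - 2 H)`. -/
theorem tendsto_intensity_symmDiff_coverSet (hKc : IsCompact K) (hc : Convex ℝ K)
    (hK : (interior K).Nonempty) (z w : EuclideanSpace ℝ (Fin d)) :
    Tendsto (fun H : ℝ => (1 - 2 * H) *
      (intensity d H).real (symmDiff (coverSet K z) (coverSet K w))) (𝓝[<] (1 / 2))
      (𝓝 (projNorm K (z - w))) := by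
  simp_rw [measureReal_intensity_symmDiff_coverSet hKc]
  have h1 := tendsto_one_sub_mul_integral_rpow_mul (C := 2 * volume.real K)
    (ψ := fun r => symmDiffVol K (r⁻¹ • (z - w)))
    (C' := projNorm K (z - w)) (L := projNorm K (z - w))
    ((measurable_symmDiffVol hKc).comp (by fun_prop)) (fun _ => symmDiffVol_nonneg _)
    (fun _ => symmDiffVol_le_two_mul hKc _)
    (fun r hr => by
      rw [← le_inv_mul_iff₀ hr]
      have h := symmDiffVol_le_projNorm hKc hc hK (r⁻¹ • (z - w))
      rwa [projNorm_smul hKc hc hK, Real.norm_of_nonneg (inv_nonneg.2 hr.le)] at h)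
    (by
      refine ((tendsto_symmDiffVol_div hKc hc hK (z - w)).comp tendsto_inv_atTop_nhdsGT_zero).congr
        fun r => ?_
      simp [div_eq_mul_inv, mul_comm])
  have h2 : Tendsto (fun H : ℝ => 2 * H) (𝓝[<] (1 / 2)) (𝓝[<] 1) := by
    refine tendsto_nhdsWithin_iff.2 ⟨?_, ?_⟩
    · have : Tendsto (fun H : ℝ => 2 * H) (𝓝 (1 / 2)) (𝓝 (2 * (1 / 2))) := tendsto_id.const_mul _
      rw [mul_one_div_cancel two_ne_zero] at this
      exact this.mono_left nhdsWithin_le_nhds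
    · filter_upwards [self_mem_nhdsWithin] with H hH
      rw [mem_Iio] at hH ⊢
      linarith
  exact h1.comp h2

theorem volume_fiber_coverSet (K : Set (EuclideanSpace ℝ (Fin d))) (z : EuclideanSpace ℝ (Fin d))
    (r : Ioi (0 : ℝ)) :
    volume ((fun x => (x, r)) ⁻¹' coverSet K z) =
      ENNReal.ofReal ((r : ℝ) ^ d) * volume K := by
  have hr : (0 : ℝ) < r := r.2
  have h : (fun x => (x, r)) ⁻¹' coverSet K z = z +ᵥ (-(r : ℝ)) • K := by
    ext x
    rw [mem_vadd_set_iff_neg_vadd_mem, mem_smul_set_iff_inv_smul_mem₀ (neg_ne_zero.2 hr.ne'),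
      mem_preimage, mem_coverSet, vadd_eq_add, inv_neg, neg_smul, ← smul_neg]
    simp [sub_eq_add_neg, add_comm]
  rw [h, measure_vadd, Measure.addHaar_smul, finrank_euclideanSpace_fin, abs_pow, abs_neg,
    abs_of_pos hr]

/-- At each fixed r the two cover sets have sections of the same finite volume, so the two
differences have equal sections. The comparison must precede the integration over r, since a cover
set has infinite intensity when K has positive volume. This symmetry makes the field kernels
centred. -/
theorem intensity_coverSet_diff (hKc : IsCompact K) (H : ℝ) (z w : EuclideanSpace ℝ (Fin d)) :
    intensity d H (coverSet K z \ coverSet K w) = intensity d H (coverSet K w \ coverSet K z) := by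
  have hz := measurableSet_coverSet hKc z
  have hw := measurableSet_coverSet hKc w
  rw [intensity_apply H (hz.diff hw), intensity_apply H (hw.diff hz)]
  refine lintegral_congr fun r => ?_
  congr 1
  have hfin : ∀ z, volume ((fun x => (x, r)) ⁻¹' coverSet K z) ≠ ∞ := fun z => by
    rw [volume_fiber_coverSet]
    exact ENNReal.mul_ne_top ENNReal.ofReal_ne_top hKc.measure_lt_top.ne
  rw [preimage_sdiff, preimage_sdiff]
  refine measure_sdiff_symm (hz.preimage (by fun_prop)).nullMeasurableSet
    (hw.preimage (by fun_prop)).nullMeasurableSet ?_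
    ((measure_mono inter_subset_left).trans_lt (hfin z).lt_top).ne
  rw [volume_fiber_coverSet, volume_fiber_coverSet]

end Grains

end

/-! ### Integrals of simple functions against a Poisson process -/

namespace IsPoissonProcess

variable {S Ω : Type*} [MeasurableSpace S] [MeasurableSpace Ω] {N : Ω → Measure S} {ν : Measure S}
  {P : Measure Ω}

theorem measurable_apply (hN : IsPoissonProcess N ν P) {B : Set S} (hB : MeasurableSet B) :
    Measurable fun ω => N ω B :=
  (Measure.measurable_coe hB).comp hN.measurable

theorem ae_lt_top (hN : IsPoissonProcess N ν P) {B : Set S} (hB : MeasurableSet B)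
    (hν : ν B < ∞) : ∀ᵐ ω ∂P, N ω B < ∞ := by
  refine ae_of_ae_map (p := fun x => x < ∞) (hN.measurable_apply hB).aemeasurable ?_
  rw [hN.poisson B hB hν, ae_map_iff (by fun_prop) measurableSet_Iio]
  exact ae_of_all _ fun n => ENNReal.natCast_lt_top n

theorem map_measureReal (hN : IsPoissonProcess N ν P) {B : Set S} (hB : MeasurableSet B)
    (hν : ν B < ∞) :
    P.map (fun ω => (N ω).real B) = (poissonMeasure (ν B).toNNReal).map (Nat.cast : ℕ → ℝ) := by
  have h : (fun ω => (N ω).real B) = ENNReal.toReal ∘ fun ω => N ω B := rfl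
  rw [h, ← Measure.map_map ENNReal.measurable_toReal (hN.measurable_apply hB), hN.poisson B hB hν,
    Measure.map_map ENNReal.measurable_toReal .of_discrete]
  congr 1

theorem iIndepFun_measureReal (hN : IsPoissonProcess N ν P) {ι : Type*} [Finite ι] {B : ι → Set S}
    (hB : ∀ i, MeasurableSet (B i)) (hd : Pairwise fun i j => Disjoint (B i) (B j)) :
    iIndepFun (fun i ω => (N ω).real (B i)) P := by
  obtain ⟨n, ⟨e⟩⟩ := Finite.exists_equiv_fin ι
  have h := hN.indep n (fun i => B (e.symm i)) (fun i => hB _)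
    fun i j hij => hd (e.symm.injective.ne hij)
  have h1 : iIndepFun (fun i ω => N ω (B i)) P := by
    have := h.precomp (g := e) e.injective
    simpa using this
  exact h1.comp (fun _ => ENNReal.toReal) fun _ => ENNReal.measurable_toReal

variable (g : SimpleFunc S ℝ)

/-- A simple function is integrable exactly when its support has finite measure, and a set of finite
intensity almost surely has finitely many points. -/
theorem ae_integrable (hN : IsPoissonProcess N ν P) (hg : Integrable g ν) :
    ∀ᵐ ω ∂P, Integrable g (N ω) := by
  have hm : MeasurableSet (Function.support g) := g.measurableSet_support
  have hfin : ν (Function.support g) < ∞ :=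
    SimpleFunc.finMeasSupp_iff_support.1 (SimpleFunc.integrable_iff_finMeasSupp.1 hg)
  filter_upwards [hN.ae_lt_top hm hfin] with ω hω
  exact SimpleFunc.integrable_iff_finMeasSupp.2 (SimpleFunc.finMeasSupp_iff_support.2 hω)

theorem ae_integral_eq_sum (hN : IsPoissonProcess N ν P) (hg : Integrable g ν) :
    (fun ω => ∫ x, g x ∂N ω) =ᵐ[P]
      fun ω => ∑ i : {x // x ∈ g.range.filter (· ≠ 0)}, (i : ℝ) * (N ω).real (g ⁻¹' {(i : ℝ)}) := by
  filter_upwards [hN.ae_integrable g hg] with ω hω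
  rw [← SimpleFunc.integral_eq_integral g hω, SimpleFunc.integral_eq_sum_filter,
    Finset.sum_coe_sort (g.range.filter (· ≠ 0)) fun x => x * (N ω).real (g ⁻¹' {x})]
  simp_rw [smul_eq_mul, mul_comm]

theorem aemeasurable_integral (hN : IsPoissonProcess N ν P) (hg : Integrable g ν) :
    AEMeasurable (fun ω => ∫ x, g x ∂N ω) P := by
  refine AEMeasurable.congr ?_ (hN.ae_integral_eq_sum g hg).symm
  exact (Finset.measurable_fun_sum _ fun i _ => (hN.measurable_apply
    (g.measurableSet_fiber _)).ennreal_toReal.const_mul _).aemeasurable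

/-- The characteristic function of the integral of a simple function against a Poisson process. -/
theorem charFun_integral [IsProbabilityMeasure P] (hN : IsPoissonProcess N ν P)
    (hg : Integrable g ν) (t : ℝ) :
    charFun (P.map fun ω => ∫ x, g x ∂N ω) t =
      Complex.exp (∫ x, (Complex.exp (t * g x * Complex.I) - 1) ∂ν) := by
  have hmeas : ∀ i : {x // x ∈ g.range.filter (· ≠ 0)},
      Measurable fun ω => (N ω).real (g ⁻¹' {(i : ℝ)}) := fun i =>
    (hN.measurable_apply (g.measurableSet_fiber _)).ennreal_toReal
  -- Fibres over distinct values are disjoint, so their counts are independent. The value 0 is left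
  -- out: its fibre may have infinite intensity, and it contributes nothing to the integral or to
  -- the exponent.
  have hind := (hN.iIndepFun_measureReal (ι := {x // x ∈ g.range.filter (· ≠ 0)}) (B := fun i : {x // x ∈ g.range.filter (· ≠ 0)} =>
    g ⁻¹' {(i : ℝ)}) (fun i => g.measurableSet_fiber _) fun i j hij => by
      refine Disjoint.preimage _ (disjoint_singleton.2 fun h => hij (Subtype.ext h))).comp
    (fun i x => (i : ℝ) * x) fun i => measurable_const_mul _
  rw [Measure.map_congr (hN.ae_integral_eq_sum g hg), iIndepFun.charFun_map_fun_sum_eq_prod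
    (X := fun (i : {x // x ∈ g.range.filter (· ≠ 0)}) ω => (i : ℝ) * (N ω).real (g ⁻¹' {(i : ℝ)}))
    (fun i => ((hmeas i).const_mul _).aemeasurable) hind, Finset.prod_apply]
  have hfac : ∀ i : {x // x ∈ g.range.filter (· ≠ 0)},
      charFun (P.map fun ω => (i : ℝ) * (N ω).real (g ⁻¹' {(i : ℝ)})) t =
      Complex.exp (ν.real (g ⁻¹' {(i : ℝ)}) • (Complex.exp (t * (i : ℝ) * Complex.I) - 1)) := by
    intro i
    have hfin : ν (g ⁻¹' {(i : ℝ)}) < ∞ :=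
      SimpleFunc.integrable_iff_finMeasSupp.1 hg |>.meas_preimage_singleton_ne_zero
        (Finset.mem_filter.1 i.2).2
    rw [charFun_map_mul_comp (hmeas i).aemeasurable, hN.map_measureReal (g.measurableSet_fiber _)
      hfin, charFun_map_cast_poissonMeasure, Complex.real_smul, measureReal_def]
    push_cast
    rw [mul_comm (t : ℂ)]
  have hint : ∫ x, (Complex.exp (t * g x * Complex.I) - 1) ∂ν =
      ∑ x ∈ g.range, ν.real (g ⁻¹' {x}) • (Complex.exp (t * x * Complex.I) - 1) := by
    have h0 : Complex.exp (t * (0 : ℝ) * Complex.I) - 1 = 0 := by simp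
    rw [← SimpleFunc.map_integral g (fun x : ℝ => Complex.exp (t * x * Complex.I) - 1) hg h0,
      SimpleFunc.integral_eq_integral]
    · rfl
    · exact SimpleFunc.integrable_iff_finMeasSupp.2
        ((SimpleFunc.integrable_iff_finMeasSupp.1 hg).map h0)
  rw [Finset.prod_congr rfl fun i _ => hfac i, ← Complex.exp_sum, hint,
    Finset.sum_coe_sort (g.range.filter (· ≠ 0)) fun x =>
      ν.real (g ⁻¹' {x}) • (Complex.exp (t * x * Complex.I) - 1)]
  congr 1
  refine Finset.sum_filter_of_ne fun x _ hx h => hx ?_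
  simp [h]

end IsPoissonProcess

/-! ### Gaussian limits of compensated Poisson characteristic functions -/

section GaussianLimit

theorem norm_exp_mul_I_sub_taylor_le {x : ℝ} (hx : |x| ≤ 1) :
    ‖Complex.exp (x * Complex.I) - 1 - x * Complex.I + x ^ 2 / 2‖ ≤ |x| ^ 3 := by
  have h := Complex.exp_bound (x := x * Complex.I) (by simpa using hx) (n := 3) (by norm_num)
  have h2 : ∑ m ∈ Finset.range 3, ((x : ℂ) * Complex.I) ^ m / m.factorial =
      1 + x * Complex.I - x ^ 2 / 2 := by
    simp only [Finset.sum_range_succ, Finset.sum_range_zero, Nat.factorial, mul_pow, Complex.I_sq]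
    push_cast
    ring
  rw [h2] at h
  have h3 : Complex.exp (x * Complex.I) - 1 - x * Complex.I + (x : ℂ) ^ 2 / 2 =
      Complex.exp (x * Complex.I) - (1 + x * Complex.I - x ^ 2 / 2) := by ring
  rw [h3]
  refine h.trans ?_
  rw [norm_mul, Complex.norm_I, mul_one, Complex.norm_real, Real.norm_eq_abs]
  -- The constant of the third-order exponential bound is 4 / (3! · 3), which is below 1.
  refine mul_le_of_le_one_right (by positivity) ?_
  norm_num [Nat.factorial]

variable {S ι : Type*} [MeasurableSpace S] {l : Filter ι} {ν : ι → Measure S} {s : ι → ℝ} {σ : ℝ}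

theorem SimpleFunc.integrable_comp {μ : Measure S} {E F : Type*} [NormedAddCommGroup E]
    [NormedAddCommGroup F] {g : SimpleFunc S E} (hg : Integrable g μ) {f : E → F} (hf : f 0 = 0) :
    Integrable (fun x => f (g x)) μ :=
  SimpleFunc.integrable_iff_finMeasSupp.2 ((SimpleFunc.integrable_iff_finMeasSupp.1 hg).map hf)

/-- If the intensities blow up at the rate of the inverse square of the scaling, then compensated
Poisson characteristic exponents converge to Gaussian ones. -/
theorem tendsto_exp_integral_exp_sub_one (g : SimpleFunc S ℝ) (hg : ∀ i, Integrable g (ν i))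
    (hg0 : ∀ i, ∫ x, g x ∂ν i = 0) (hs : Tendsto s l (𝓝 0))
    (hσ : Tendsto (fun i => s i ^ 2 * ∫ x, g x ^ 2 ∂ν i) l (𝓝 σ)) :
    Tendsto (fun i => Complex.exp (∫ x, (Complex.exp (s i * g x * Complex.I) - 1) ∂ν i)) l
      (𝓝 (Complex.exp (-σ / 2))) := by
  obtain ⟨M, hM⟩ := g.exists_forall_norm_le
  have hg2 : ∀ i, Integrable (fun x => g x ^ 2) (ν i) := fun i =>
    SimpleFunc.integrable_comp (hg i) (f := fun y : ℝ => y ^ 2) (by simp)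
  have hge : ∀ i, Integrable (fun x => Complex.exp (s i * g x * Complex.I) - 1) (ν i) := fun i =>
    SimpleFunc.integrable_comp (hg i) (f := fun y : ℝ => Complex.exp (s i * y * Complex.I) - 1)
      (by simp)
  -- The first-order term integrates to zero by `hg0`, leaving the quadratic term and a cubic
  -- remainder.
  have hdecomp : ∀ i, ∫ x, (Complex.exp (s i * g x * Complex.I) - 1) ∂ν i =
      (∫ x, (Complex.exp (s i * g x * Complex.I) - 1 - s i * g x * Complex.I +
        (s i * g x) ^ 2 / 2) ∂ν i) - ((s i ^ 2 * ∫ x, g x ^ 2 ∂ν i : ℝ) : ℂ) / 2 := by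
    intro i
    have h1 : Integrable (fun x => (s i : ℂ) * g x * Complex.I) (ν i) :=
      ((hg i).ofReal.const_mul _).mul_const _
    have h2 : Integrable (fun x => ((s i : ℂ) * g x) ^ 2 / 2) (ν i) := by
      have h : Integrable (fun x => ((g x ^ 2 : ℝ) : ℂ)) (ν i) := (hg2 i).ofReal
      refine (h.const_mul ((s i : ℂ) ^ 2 / 2)).congr
        (ae_of_all _ fun x => ?_)
      push_cast
      ring
    have h3 : ∫ x, (s i : ℂ) * g x * Complex.I ∂ν i = 0 := by
      rw [integral_mul_const, integral_const_mul, integral_complex_ofReal, hg0]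
      simp
    have h4 : ∫ x, ((s i : ℂ) * g x) ^ 2 / 2 ∂ν i =
        ((s i ^ 2 * ∫ x, g x ^ 2 ∂ν i : ℝ) : ℂ) / 2 := by
      rw [integral_div]
      push_cast
      rw [← integral_complex_ofReal, ← integral_const_mul]
      congr 2
      ext x
      push_cast
      ring
    have h5 : Integrable (fun x => Complex.exp (s i * g x * Complex.I) - 1 -
        s i * g x * Complex.I) (ν i) := (hge i).sub h1
    rw [integral_add h5 h2, integral_sub (hge i) h1, h3, h4]
    ring
  have hrem : Tendsto (fun i => ∫ x, (Complex.exp (s i * g x * Complex.I) - 1 -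
      s i * g x * Complex.I + (s i * g x) ^ 2 / 2) ∂ν i) l (𝓝 0) := by
    -- |s g|³ ≤ |s| M · (s g)², so the remainder is a vanishing factor times the convergent second
    -- moment.
    have hbound : Tendsto (fun i => |s i| * M * (s i ^ 2 * ∫ x, g x ^ 2 ∂ν i)) l (𝓝 0) := by
      have := (hs.abs.mul_const M).mul hσ
      simpa using this
    refine squeeze_zero_norm' ?_ hbound
    have hsmall : ∀ᶠ i in l, |s i| * M < 1 := by
      have := hs.abs.mul_const M
      rw [abs_zero, zero_mul] at this
      exact this.eventually_lt_const one_pos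
    filter_upwards [hsmall] with i hi
    rw [← integral_const_mul, ← integral_const_mul]
    refine norm_integral_le_of_norm_le (((hg2 i).const_mul _).const_mul _)
      (ae_of_all _ fun x => ?_)
    have hx : |s i * g x| ≤ |s i| * M := by
      rw [abs_mul]
      exact mul_le_mul_of_nonneg_left (hM x) (abs_nonneg _)
    have h := norm_exp_mul_I_sub_taylor_le (hx.trans hi.le)
    push_cast at h
    refine h.trans ?_
    rw [pow_succ', ← mul_pow, ← sq_abs (s i * g x)]
    exact mul_le_mul_of_nonneg_right hx (by positivity)
  have hlim := hrem.sub ((Complex.continuous_ofReal.tendsto σ).comp hσ |>.div_const 2)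
  refine (Complex.continuous_exp.tendsto _).comp ?_
  rw [zero_sub, ← neg_div] at hlim
  exact hlim.congr fun i => (hdecomp i).symm

end GaussianLimit

noncomputable section

/-! ### Second moments of the field kernel -/

section FieldKernel

variable {d : ℕ} {K : Set (EuclideanSpace ℝ (Fin d))}

theorem fieldKernel_eq_indicator_sub (z : EuclideanSpace ℝ (Fin d)) :
    fieldKernel K z = fun q => (coverSet K z).indicator 1 q - (coverSet K 0).indicator 1 q := by
  rfl

/-- Polarization 2(a-c)(b-c) = (a-c)² + (b-c)² - (a-b)² for indicators, where the square of a
difference is the indicator of the symmetric difference. -/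
theorem fieldKernel_mul (z w : EuclideanSpace ℝ (Fin d))
    (q : EuclideanSpace ℝ (Fin d) × Ioi (0 : ℝ)) :
    fieldKernel K z q * fieldKernel K w q =
      (1 / 2) * ((symmDiff (coverSet K z) (coverSet K 0)).indicator 1 q +
        (symmDiff (coverSet K w) (coverSet K 0)).indicator 1 q -
        (symmDiff (coverSet K z) (coverSet K w)).indicator 1 q) := by
  rw [fieldKernel_eq_indicator_sub, fieldKernel_eq_indicator_sub]
  by_cases h1 : q ∈ coverSet K z <;> by_cases h2 : q ∈ coverSet K w <;>
    by_cases h3 : q ∈ coverSet K 0 <;>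
    simp [mem_symmDiff, h1, h2, h3] <;> norm_num

theorem fieldKernel_eq_indicator_diff_sub (z : EuclideanSpace ℝ (Fin d))
    (q : EuclideanSpace ℝ (Fin d) × Ioi (0 : ℝ)) :
    fieldKernel K z q = (coverSet K z \ coverSet K 0).indicator 1 q -
      (coverSet K 0 \ coverSet K z).indicator 1 q := by
  rw [fieldKernel_eq_indicator_sub]
  by_cases h1 : q ∈ coverSet K z <;> by_cases h3 : q ∈ coverSet K 0 <;>
    simp [h1, h3]

/-- The limiting covariance function. -/
def fieldCov (K : Set (EuclideanSpace ℝ (Fin d))) (z w : EuclideanSpace ℝ (Fin d)) : ℝ :=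
  (1 / 2) * (projNorm K z + projNorm K w - projNorm K (z - w))

theorem integrable_indicator_symmDiff_coverSet (hKc : IsCompact K) (hc : Convex ℝ K)
    (hK : (interior K).Nonempty) {H : ℝ} (hH : H ∈ Ioo (0 : ℝ) (1 / 2))
    (z w : EuclideanSpace ℝ (Fin d)) :
    Integrable ((symmDiff (coverSet K z) (coverSet K w)).indicator (fun _ => (1 : ℝ)))
      (intensity d H) :=
  (integrable_indicator_iff ((measurableSet_coverSet hKc z).symmDiff
    (measurableSet_coverSet hKc w))).2
    (integrableOn_const (intensity_symmDiff_coverSet_ne_top hKc hc hK hH z w))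

theorem integral_indicator_symmDiff_coverSet (hKc : IsCompact K) (H : ℝ)
    (z w : EuclideanSpace ℝ (Fin d)) :
    ∫ q, (symmDiff (coverSet K z) (coverSet K w)).indicator (fun _ => (1 : ℝ)) q ∂intensity d H =
      (intensity d H).real (symmDiff (coverSet K z) (coverSet K w)) :=
  integral_indicator_one ((measurableSet_coverSet hKc z).symmDiff (measurableSet_coverSet hKc w))

theorem measurable_fieldKernel (hKc : IsCompact K) (z : EuclideanSpace ℝ (Fin d)) :
    Measurable (fieldKernel K z) := by
  rw [fieldKernel_eq_indicator_sub]
  exact (measurable_one.indicator (measurableSet_coverSet hKc z)).sub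
    (measurable_one.indicator (measurableSet_coverSet hKc 0))

theorem integrable_fieldKernel (hKc : IsCompact K) (hc : Convex ℝ K)
    (hK : (interior K).Nonempty) {H : ℝ} (hH : H ∈ Ioo (0 : ℝ) (1 / 2))
    (z : EuclideanSpace ℝ (Fin d)) : Integrable (fieldKernel K z) (intensity d H) := by
  refine (integrable_indicator_symmDiff_coverSet hKc hc hK hH z 0).mono'
    (measurable_fieldKernel hKc z).aestronglyMeasurable (ae_of_all _ fun q => ?_)
  rw [fieldKernel_eq_indicator_sub]
  by_cases h1 : q ∈ coverSet K z <;> by_cases h3 : q ∈ coverSet K 0 <;>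
    simp [mem_symmDiff, h1, h3]

theorem integral_fieldKernel (hKc : IsCompact K) (hc : Convex ℝ K)
    (hK : (interior K).Nonempty) {H : ℝ} (hH : H ∈ Ioo (0 : ℝ) (1 / 2))
    (z : EuclideanSpace ℝ (Fin d)) : ∫ q, fieldKernel K z q ∂intensity d H = 0 := by
  have hm := (measurableSet_coverSet hKc z).diff (measurableSet_coverSet hKc 0)
  have hm' := (measurableSet_coverSet hKc 0).diff (measurableSet_coverSet hKc z)
  have hfin := intensity_symmDiff_coverSet_ne_top hKc hc hK hH z 0
  have h1 : Integrable ((coverSet K z \ coverSet K 0).indicator (1 : _ × _ → ℝ))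
      (intensity d H) := (integrable_indicator_iff hm).2 (integrableOn_const (C := (1 : ℝ))
    ((measure_mono (fun q hq => Or.inl hq)).trans_lt hfin.lt_top).ne)
  have h2 : Integrable ((coverSet K 0 \ coverSet K z).indicator (1 : _ × _ → ℝ))
      (intensity d H) := (integrable_indicator_iff hm').2 (integrableOn_const (C := (1 : ℝ))
    ((measure_mono (fun q hq => Or.inr hq)).trans_lt hfin.lt_top).ne)
  simp_rw [fieldKernel_eq_indicator_diff_sub]
  rw [integral_sub h1 h2, integral_indicator_one hm, integral_indicator_one hm', measureReal_def,
    measureReal_def, intensity_coverSet_diff hKc, sub_self]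

theorem integrable_fieldKernel_mul (hKc : IsCompact K) (hc : Convex ℝ K)
    (hK : (interior K).Nonempty) {H : ℝ} (hH : H ∈ Ioo (0 : ℝ) (1 / 2))
    (z w : EuclideanSpace ℝ (Fin d)) :
    Integrable (fun q => fieldKernel K z q * fieldKernel K w q) (intensity d H) := by
  simp_rw [fieldKernel_mul]
  exact (((integrable_indicator_symmDiff_coverSet hKc hc hK hH z 0).add
    (integrable_indicator_symmDiff_coverSet hKc hc hK hH w 0)).sub
    (integrable_indicator_symmDiff_coverSet hKc hc hK hH z w)).const_mul _

theorem integral_fieldKernel_mul (hKc : IsCompact K) (hc : Convex ℝ K)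
    (hK : (interior K).Nonempty) {H : ℝ} (hH : H ∈ Ioo (0 : ℝ) (1 / 2))
    (z w : EuclideanSpace ℝ (Fin d)) :
    ∫ q, fieldKernel K z q * fieldKernel K w q ∂intensity d H =
      (1 / 2) * ((intensity d H).real (symmDiff (coverSet K z) (coverSet K 0)) +
        (intensity d H).real (symmDiff (coverSet K w) (coverSet K 0)) -
        (intensity d H).real (symmDiff (coverSet K z) (coverSet K w))) := by
  have h1 := integrable_indicator_symmDiff_coverSet hKc hc hK hH z 0
  have h2 := integrable_indicator_symmDiff_coverSet hKc hc hK hH w 0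
  have h3 := integrable_indicator_symmDiff_coverSet hKc hc hK hH z w
  simp_rw [fieldKernel_mul]
  rw [integral_const_mul, ← integral_indicator_symmDiff_coverSet hKc,
    ← integral_indicator_symmDiff_coverSet hKc, ← integral_indicator_symmDiff_coverSet hKc,
    ← integral_add h1 h2]
  congr 1
  exact integral_sub (h1.add h2) h3

theorem tendsto_integral_fieldKernel_mul (hKc : IsCompact K) (hc : Convex ℝ K)
    (hK : (interior K).Nonempty) (z w : EuclideanSpace ℝ (Fin d)) :
    Tendsto (fun H : ℝ => (1 - 2 * H) * ∫ q, fieldKernel K z q * fieldKernel K w q ∂intensity d H)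
      (𝓝[<] (1 / 2)) (𝓝 (fieldCov K z w)) := by
  have h := (((tendsto_intensity_symmDiff_coverSet hKc hc hK z 0).add
    (tendsto_intensity_symmDiff_coverSet hKc hc hK w 0)).sub
    (tendsto_intensity_symmDiff_coverSet hKc hc hK z w)).const_mul (1 / 2)
  rw [sub_zero, sub_zero] at h
  refine h.congr' ?_
  filter_upwards [Ioo_mem_nhdsLT (by norm_num : (0 : ℝ) < 1 / 2)] with H hH
  rw [integral_fieldKernel_mul hKc hc hK hH]
  ring

/-- A linear combination of field kernels, as a simple function. -/
def kernelCombination {k : ℕ} (hKc : IsCompact K) (z : Fin k → EuclideanSpace ℝ (Fin d))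
    (c : Fin k → ℝ) : SimpleFunc (EuclideanSpace ℝ (Fin d) × Ioi (0 : ℝ)) ℝ where
  toFun q := ∑ j, c j * fieldKernel K (z j) q
  measurableSet_fiber' x := (Finset.measurable_fun_sum _ fun j _ =>
    (measurable_fieldKernel hKc (z j)).const_mul (c j)) (measurableSet_singleton x)
  finite_range' := by
    have h : (Set.pi univ fun _ : Fin k => ({-1, 0, 1} : Set ℝ)).Finite :=
      Set.Finite.pi fun _ => Set.toFinite _
    refine (h.image fun f => ∑ j, c j * f j).subset ?_
    rintro _ ⟨q, rfl⟩
    refine ⟨fun j => fieldKernel K (z j) q, fun j _ => ?_, rfl⟩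
    change fieldKernel K (z j) q ∈ ({-1, 0, 1} : Set ℝ)
    rw [fieldKernel_eq_indicator_sub]
    by_cases h1 : q ∈ coverSet K (z j) <;> by_cases h3 : q ∈ coverSet K 0 <;> simp [h1, h3]

variable {k : ℕ} (z : Fin k → EuclideanSpace ℝ (Fin d)) (c : Fin k → ℝ)

theorem kernelCombination_apply (hKc : IsCompact K) (q : EuclideanSpace ℝ (Fin d) × Ioi (0 : ℝ)) :
    kernelCombination hKc z c q = ∑ j, c j * fieldKernel K (z j) q := rfl

theorem integrable_kernelCombination (hKc : IsCompact K) (hc : Convex ℝ K)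
    (hK : (interior K).Nonempty) {H : ℝ} (hH : H ∈ Ioo (0 : ℝ) (1 / 2)) :
    Integrable (kernelCombination hKc z c) (intensity d H) :=
  integrable_finsetSum Finset.univ (f := fun j q => c j * fieldKernel K (z j) q) fun j _ =>
    (integrable_fieldKernel hKc hc hK hH (z j)).const_mul (c j)

theorem integral_kernelCombination (hKc : IsCompact K) (hc : Convex ℝ K)
    (hK : (interior K).Nonempty) {H : ℝ} (hH : H ∈ Ioo (0 : ℝ) (1 / 2)) :
    ∫ q, kernelCombination hKc z c q ∂intensity d H = 0 := by
  simp_rw [kernelCombination_apply]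
  rw [integral_finsetSum _ fun j _ => (integrable_fieldKernel hKc hc hK hH (z j)).const_mul (c j)]
  simp [integral_const_mul, integral_fieldKernel hKc hc hK hH]

theorem integral_sq_kernelCombination (hKc : IsCompact K) (hc : Convex ℝ K)
    (hK : (interior K).Nonempty) {H : ℝ} (hH : H ∈ Ioo (0 : ℝ) (1 / 2)) :
    ∫ q, kernelCombination hKc z c q ^ 2 ∂intensity d H =
      ∑ i, ∑ j, c i * c j * ∫ q, fieldKernel K (z i) q * fieldKernel K (z j) q ∂intensity d H := by
  have h : ∀ q, kernelCombination hKc z c q ^ 2 =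
      ∑ i, ∑ j, c i * c j * (fieldKernel K (z i) q * fieldKernel K (z j) q) := fun q => by
    rw [kernelCombination_apply, sq, Finset.sum_mul_sum]
    refine Finset.sum_congr rfl fun i _ => Finset.sum_congr rfl fun j _ => by ring
  have hi := fun i j => (integrable_fieldKernel_mul hKc hc hK hH (z i) (z j)).const_mul (c i * c j)
  simp_rw [h]
  rw [integral_finsetSum _ fun i _ => integrable_finsetSum _ fun j _ => hi i j]
  refine Finset.sum_congr rfl fun i _ => ?_
  rw [integral_finsetSum _ fun j _ => hi i j]
  simp_rw [integral_const_mul]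

theorem tendsto_integral_sq_kernelCombination (hKc : IsCompact K) (hc : Convex ℝ K)
    (hK : (interior K).Nonempty) :
    Tendsto (fun H : ℝ => (1 - 2 * H) * ∫ q, kernelCombination hKc z c q ^ 2 ∂intensity d H)
      (𝓝[<] (1 / 2)) (𝓝 (∑ i, ∑ j, c i * c j * fieldCov K (z i) (z j))) := by
  have h : Tendsto (fun H : ℝ => ∑ i, ∑ j, c i * c j * ((1 - 2 * H) *
      ∫ q, fieldKernel K (z i) q * fieldKernel K (z j) q ∂intensity d H))
      (𝓝[<] (1 / 2)) (𝓝 (∑ i, ∑ j, c i * c j * fieldCov K (z i) (z j))) :=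
    tendsto_finsetSum _ fun i _ => tendsto_finsetSum _ fun j _ =>
      (tendsto_integral_fieldKernel_mul hKc hc hK (z i) (z j)).const_mul _
  refine h.congr' ?_
  filter_upwards [Ioo_mem_nhdsLT (by norm_num : (0 : ℝ) < 1 / 2)] with H hH
  rw [integral_sq_kernelCombination z c hKc hc hK hH, Finset.mul_sum]
  refine Finset.sum_congr rfl fun i _ => ?_
  rw [Finset.mul_sum]
  exact Finset.sum_congr rfl fun j _ => mul_left_comm _ _ _

/-- The quadratic form is a limit of nonnegative multiples of integrals of squares. This positivity
is what the existence of the Gaussian field rests on. -/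
theorem sum_mul_fieldCov_nonneg (hKc : IsCompact K) (hc : Convex ℝ K) (hK : (interior K).Nonempty) :
    0 ≤ ∑ i, ∑ j, c i * c j * fieldCov K (z i) (z j) := by
  refine ge_of_tendsto (tendsto_integral_sq_kernelCombination z c hKc hc hK) ?_
  filter_upwards [self_mem_nhdsWithin] with H hH
  rw [mem_Iio] at hH
  exact mul_nonneg (by linarith) (integral_nonneg fun q => sq_nonneg _)

theorem fieldCov_comm (hKc : IsCompact K) (hc : Convex ℝ K) (hK : (interior K).Nonempty)
    (z w : EuclideanSpace ℝ (Fin d)) : fieldCov K z w = fieldCov K w z := by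
  rw [fieldCov, fieldCov, ← projNorm_neg hKc hc hK (z - w), neg_sub]
  ring

end FieldKernel

end

noncomputable section

/-! ### Isonormal Gaussian processes -/

section Isonormal

variable {ι : Type*}

/-- The law of a family of independent standard Gaussian random variables. -/
abbrev stdGaussianFamily (ι : Type*) : Measure (ι → ℝ) :=
  Measure.infinitePi fun _ : ι => gaussianReal 0 1

theorem memLp_eval_stdGaussianFamily (i : ι) :
    MemLp (fun ω : ι → ℝ => ω i) 2 (stdGaussianFamily ι) :=
  (memLp_id_gaussianReal' 2 (by simp)).comp_measurePreserving
    (measurePreserving_eval_infinitePi (fun _ : ι => gaussianReal 0 1) i)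

/-- The coordinates of a family of independent standard Gaussians, as elements of `L²`. -/
def gaussianCoord (i : ι) : Lp ℝ 2 (stdGaussianFamily ι) :=
  (memLp_eval_stdGaussianFamily i).toLp _

theorem coeFn_gaussianCoord (i : ι) :
    gaussianCoord i =ᵐ[stdGaussianFamily ι] fun ω => ω i :=
  (memLp_eval_stdGaussianFamily i).coeFn_toLp

theorem iIndepFun_eval_stdGaussianFamily :
    iIndepFun (fun (i : ι) (ω : ι → ℝ) => ω i) (stdGaussianFamily ι) :=
  iIndepFun_infinitePi (X := fun _ : ι => (id : ℝ → ℝ)) fun _ => measurable_id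

theorem map_eval_stdGaussianFamily (i : ι) :
    (stdGaussianFamily ι).map (fun ω => ω i) = gaussianReal 0 1 :=
  Measure.infinitePi_map_eval (fun _ : ι => gaussianReal 0 1) i

theorem integral_eval_stdGaussianFamily (i : ι) : ∫ ω, ω i ∂stdGaussianFamily ι = 0 := by
  rw [← integral_map (f := fun x : ℝ => x) (φ := fun ω : ι → ℝ => ω i)
    (measurable_pi_apply i).aemeasurable measurable_id.aestronglyMeasurable,
    map_eval_stdGaussianFamily, integral_id_gaussianReal]

theorem integral_eval_sq_stdGaussianFamily (i : ι) :
    ∫ ω, ω i * ω i ∂stdGaussianFamily ι = 1 := by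
  rw [← integral_map (f := fun x : ℝ => x * x) (φ := fun ω : ι → ℝ => ω i)
    (measurable_pi_apply i).aemeasurable (by fun_prop), map_eval_stdGaussianFamily]
  have h := variance_fun_id_gaussianReal (μ := 0) (v := 1)
  rw [variance_of_integral_eq_zero measurable_id'.aemeasurable integral_id_gaussianReal] at h
  simpa [sq] using h

theorem orthonormal_gaussianCoord : Orthonormal ℝ (gaussianCoord (ι := ι)) := by
  classical
  rw [orthonormal_iff_ite]
  intro i j
  rw [L2.inner_def]
  have h : ∫ ω, ⟪gaussianCoord i ω, gaussianCoord j ω⟫ ∂stdGaussianFamily ι =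
      ∫ ω, ω i * ω j ∂stdGaussianFamily ι := by
    refine integral_congr_ae ?_
    filter_upwards [coeFn_gaussianCoord i, coeFn_gaussianCoord j] with ω h1 h2
    rw [h1, h2]
    simp [mul_comm]
  rw [h]
  split_ifs with hij
  · rw [hij, integral_eval_sq_stdGaussianFamily]
  · have := (iIndepFun_eval_stdGaussianFamily (ι := ι)).indepFun hij
    rw [this.integral_fun_mul_eq_mul_integral (measurable_pi_apply i).aestronglyMeasurable
      (measurable_pi_apply j).aestronglyMeasurable, integral_eval_stdGaussianFamily, zero_mul]

variable {E : Type*} [NormedAddCommGroup E] [InnerProductSpace ℝ E]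

/-- The isonormal Gaussian process with respect to a Hilbert basis. -/
def HilbertBasis.isonormal (b : HilbertBasis ι ℝ E) : E →ₗᵢ[ℝ] Lp ℝ 2 (stdGaussianFamily ι) :=
  orthonormal_gaussianCoord.orthogonalFamily.linearIsometry.comp b.repr.toLinearIsometry

theorem HilbertBasis.isonormal_apply_self (b : HilbertBasis ι ℝ E) (i : ι) :
    b.isonormal (b i) = gaussianCoord i := by
  classical
  change orthonormal_gaussianCoord.orthogonalFamily.linearIsometry (b.repr (b i)) = _
  rw [b.repr_self, OrthogonalFamily.linearIsometry_apply_single]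
  simp

theorem coeFn_sum_smul {Ω κ : Type*} [MeasurableSpace Ω] {μ : Measure Ω} (s : Finset κ) (c : κ → ℝ)
    (f : κ → Lp ℝ 2 μ) :
    (∑ i ∈ s, c i • f i : Lp ℝ 2 μ) =ᵐ[μ] fun ω => ∑ i ∈ s, c i * f i ω := by
  have h : ∀ᵐ ω ∂μ, ∀ i ∈ s, (c i • f i : Lp ℝ 2 μ) ω = c i * f i ω :=
    (ae_ball_iff s.countable_toSet).2 fun i _ => Lp.coeFn_smul (c i) (f i)
  filter_upwards [Lp.coeFn_finsetSum s fun i => c i • f i, h] with ω h1 h2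
  rw [h1, Finset.sum_apply]
  exact Finset.sum_congr rfl h2

theorem coeFn_linearCombination_gaussianCoord (l : ι →₀ ℝ) :
    Finsupp.linearCombination ℝ gaussianCoord l =ᵐ[stdGaussianFamily ι]
      fun ω => ∑ i ∈ l.support, l i * ω i := by
  rw [Finsupp.linearCombination_apply, Finsupp.sum]
  refine (coeFn_sum_smul _ _ _).trans ?_
  have h : ∀ᵐ ω ∂stdGaussianFamily ι, ∀ i ∈ l.support, gaussianCoord i ω = ω i :=
    (ae_ball_iff l.support.countable_toSet).2 fun i _ => coeFn_gaussianCoord i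
  filter_upwards [h] with ω hω
  exact Finset.sum_congr rfl fun i hi => by rw [hω i hi]

theorem HilbertBasis.charFun_isonormal_linearCombination (b : HilbertBasis ι ℝ E) (l : ι →₀ ℝ)
    (t : ℝ) : charFun ((stdGaussianFamily ι).map
        (b.isonormal (Finsupp.linearCombination ℝ b l))) t =
      Complex.exp (-(‖Finsupp.linearCombination ℝ b l‖ ^ 2 * t ^ 2 / 2)) := by
  have h1 : b.isonormal (Finsupp.linearCombination ℝ b l) =
      Finsupp.linearCombination ℝ gaussianCoord l := by
    rw [Finsupp.linearCombination_apply, Finsupp.linearCombination_apply, Finsupp.sum, map_sum]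
    simp_rw [map_smul, b.isonormal_apply_self]
    rfl
  have h2 : ‖Finsupp.linearCombination ℝ b l‖ ^ 2 = ∑ i ∈ l.support, l i ^ 2 := by
    rw [← real_inner_self_eq_norm_sq, b.orthonormal.inner_finsupp_eq_sum_left, Finsupp.sum]
    simp [sq]
  have hind := ((iIndepFun_eval_stdGaussianFamily (ι := ι)).comp (fun i x => l i * x)
    fun i => measurable_const_mul _).restrict l.support
  rw [h1, Measure.map_congr (coeFn_linearCombination_gaussianCoord l),
    iIndepFun.charFun_map_fun_finsetSum_eq_prod (X := fun i (ω : ι → ℝ) => l i * ω i)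
    (fun i _ => ((measurable_pi_apply i).const_mul _).aemeasurable) hind, Finset.prod_apply]
  have h3 : ∀ i ∈ l.support, charFun ((stdGaussianFamily ι).map fun ω => l i * ω i) t =
      Complex.exp (-(l i ^ 2 * t ^ 2 / 2)) := fun i _ => by
    rw [charFun_map_mul_comp (measurable_pi_apply i).aemeasurable, map_eval_stdGaussianFamily,
      charFun_gaussianReal]
    congr 1
    push_cast
    simp
    ring
  rw [Finset.prod_congr rfl h3, ← Complex.exp_sum, Finset.sum_neg_distrib, ← Finset.sum_div,
    ← Finset.sum_mul, ← Complex.ofReal_pow ‖_‖, h2]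
  push_cast
  rfl

/-- Finite combinations of basis vectors give sums of independent Gaussians. They are dense, and
convergence in L² implies convergence in distribution, so the formula passes to the limit. -/
theorem HilbertBasis.charFun_isonormal (b : HilbertBasis ι ℝ E) (x : E) (t : ℝ) :
    charFun ((stdGaussianFamily ι).map (b.isonormal x)) t =
      Complex.exp (-(‖x‖ ^ 2 * t ^ 2 / 2)) := by
  have hx : x ∈ closure (Submodule.span ℝ (range b) : Set E) := by
    rw [← Submodule.topologicalClosure_coe, b.dense_span]
    trivial
  obtain ⟨y, hy, hlim⟩ := mem_closure_iff_seq_limit.1 hx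
  choose l hl using fun n => Finsupp.mem_span_range_iff_exists_finsupp.1 (hy n)
  have hW : Tendsto (fun n => b.isonormal (y n)) atTop (𝓝 (b.isonormal x)) :=
    (b.isonormal.continuous.tendsto x).comp hlim
  have hd := (tendstoInMeasure_of_tendsto_Lp hW).tendstoInDistribution fun n =>
    (Lp.aestronglyMeasurable _).aemeasurable
  have h1 := ProbabilityMeasure.tendsto_iff_tendsto_charFun.1 hd.tendsto t
  have h2 : Tendsto (fun n => Complex.exp (-((‖y n‖ : ℂ) ^ 2 * t ^ 2 / 2))) atTop
      (𝓝 (Complex.exp (-((‖x‖ : ℂ) ^ 2 * t ^ 2 / 2)))) := by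
    have hc : Continuous fun z : E => Complex.exp (-((‖z‖ : ℂ) ^ 2 * t ^ 2 / 2)) := by fun_prop
    exact (hc.tendsto x).comp hlim
  refine tendsto_nhds_unique h1 (h2.congr fun n => ?_)
  have h3 := b.charFun_isonormal_linearCombination (l n) t
  rw [Finsupp.linearCombination_apply, hl n] at h3
  exact h3.symm

theorem HilbertBasis.map_isonormal (b : HilbertBasis ι ℝ E) (x : E) :
    (stdGaussianFamily ι).map (b.isonormal x) = gaussianReal 0 (‖x‖₊ ^ 2) := by
  have : IsProbabilityMeasure ((stdGaussianFamily ι).map (b.isonormal x)) :=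
    Measure.isProbabilityMeasure_map (Lp.aestronglyMeasurable _).aemeasurable
  refine Measure.ext_of_charFun ?_
  ext t
  rw [b.charFun_isonormal, charFun_gaussianReal]
  congr 1
  push_cast
  simp

/-- By linearity, any linear functional of a finite-dimensional marginal is almost everywhere the
image of a single vector of E, whose law is Gaussian by `map_isonormal`. -/
theorem HilbertBasis.isGaussianProcess_isonormal (b : HilbertBasis ι ℝ E) {T : Type*} (φ : T → E) :
    IsGaussianProcess (fun z ω => b.isonormal (φ z) ω) (stdGaussianFamily ι) where
  hasGaussianLaw I := by
    have hm : AEMeasurable (fun ω => I.restrict fun z => b.isonormal (φ z) ω)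
        (stdGaussianFamily ι) :=
      aemeasurable_pi_lambda _ fun i => (Lp.aestronglyMeasurable _).aemeasurable
    refine ⟨isGaussian_of_map_eq_gaussianReal fun L => ?_⟩
    classical
    rw [AEMeasurable.map_map_of_aemeasurable L.continuous.measurable.aemeasurable hm]
    set x : E := ∑ i : I, L (Pi.single i 1) • φ i with hx
    refine ⟨0, ‖x‖₊ ^ 2, ?_⟩
    rw [← b.map_isonormal]
    refine Measure.map_congr ?_
    have h1 : b.isonormal x = ∑ i : I, L (Pi.single i 1) • b.isonormal (φ i) := by
      simp [hx]
    rw [h1]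
    filter_upwards [coeFn_sum_smul Finset.univ (fun i : I => L (Pi.single i 1))
      fun i : I => b.isonormal (φ i)] with ω hω
    rw [hω, Function.comp_apply, ← Finset.univ_sum_single (I.restrict fun z => b.isonormal (φ z) ω),
      map_sum]
    refine Finset.sum_congr rfl fun i _ => ?_
    rw [← mul_one (I.restrict _ i), ← smul_eq_mul, ← smul_eq_mul, Pi.single_smul, map_smul,
      smul_eq_mul, mul_comm]
    rfl

theorem HilbertBasis.integral_isonormal (b : HilbertBasis ι ℝ E) (x : E) :
    ∫ ω, b.isonormal x ω ∂stdGaussianFamily ι = 0 := by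
  rw [← integral_map (f := fun x : ℝ => x) (φ := b.isonormal x)
    (Lp.aestronglyMeasurable _).aemeasurable measurable_id.aestronglyMeasurable, b.map_isonormal,
    integral_id_gaussianReal]

theorem HilbertBasis.integral_isonormal_mul (b : HilbertBasis ι ℝ E) (x y : E) :
    ∫ ω, b.isonormal x ω * b.isonormal y ω ∂stdGaussianFamily ι = ⟪x, y⟫ := by
  rw [← b.isonormal.inner_map_map, L2.inner_def]
  refine integral_congr_ae (ae_of_all _ fun ω => ?_)
  simp [mul_comm]

end Isonormal

/-! ### Gaussian processes with a prescribed positive semidefinite covariance. -/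

section Existence

/-- A positive semidefinite kernel is a Gram matrix in a Hilbert space. -/
theorem exists_gram_of_posSemidef {T : Type} (C : T → T → ℝ) (hsymm : ∀ x y, C x y = C y x)
    (hpos : ∀ (k : ℕ) (z : Fin k → T) (c : Fin k → ℝ), 0 ≤ ∑ i, ∑ j, c i * c j * C (z i) (z j)) :
    ∃ (E : Type) (_ : NormedAddCommGroup E) (_ : InnerProductSpace ℝ E) (_ : CompleteSpace E)
      (φ : T → E), ∀ x y, ⟪φ x, φ y⟫ = C x y := by
  -- The scalar kernel is encoded as the operator-valued kernel C(x, y) · id on ℝ; the feature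
  -- vectors of its reproducing kernel Hilbert space, evaluated at 1, have Gram matrix C.
  let M : Matrix T T (ℝ →L[ℝ] ℝ) := .of fun x y => C x y • ContinuousLinearMap.id ℝ ℝ
  have hM : M.PosSemidef := by
    have htfae := RKHS.posSemidef_tfae (𝕜 := ℝ) (V := ℝ) (K := M)
    have hiff : M.PosSemidef ↔ M.IsHermitian ∧ ∀ f : T →₀ ℝ,
        0 ≤ RCLike.re (f.sum fun x w => f.sum fun x' w' => ⟪M x' x w, w'⟫) := htfae.out 0 2
    refine hiff.2 ⟨?_, fun f => ?_⟩
    · ext x y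
      have hstar : star (ContinuousLinearMap.id ℝ ℝ) = ContinuousLinearMap.id ℝ ℝ := star_one _
      simp [M, Matrix.conjTranspose_apply, hsymm y x, hstar]
    · obtain ⟨e⟩ : Nonempty (f.support ≃ Fin f.support.card) := ⟨f.support.equivFin⟩
      have h := hpos f.support.card (fun i => (e.symm i : T)) fun i => f (e.symm i)
      have h1 : f.sum (fun x w => f.sum fun x' w' => ⟪M x' x w, w'⟫) =
          ∑ i, ∑ j, f (e.symm i) * f (e.symm j) * C (e.symm i) (e.symm j) := by
        have h2 : f.sum (fun x w => f.sum fun x' w' => ⟪M x' x w, w'⟫) =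
            ∑ x ∈ f.support, ∑ y ∈ f.support, f x * f y * C x y := by
          refine Finset.sum_congr rfl fun x _ => Finset.sum_congr rfl fun y _ => ?_
          simp [M, hsymm y x]
          ring
        rw [h2, ← Finset.sum_coe_sort, ← e.symm.sum_comp]
        refine Finset.sum_congr rfl fun i _ => ?_
        rw [← Finset.sum_coe_sort, ← e.symm.sum_comp]
      rw [h1]
      exact h
  have : Fact M.PosSemidef := ⟨hM⟩
  refine ⟨RKHS.OfKernel M, inferInstance, inferInstance, inferInstance,
    fun x => RKHS.kerFun (𝕜 := ℝ) (RKHS.OfKernel M) x (1 : ℝ), fun x y => ?_⟩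
  rw [RKHS.kerFun_inner, RKHS.kerFun_apply, RKHS.OfKernel.kernel_ofKernel]
  simp [M]

/-- A positive semidefinite kernel is the covariance function of a centred Gaussian process. -/
theorem exists_isGaussianProcess_of_posSemidef {T : Type} (C : T → T → ℝ)
    (hsymm : ∀ x y, C x y = C y x)
    (hpos : ∀ (k : ℕ) (z : Fin k → T) (c : Fin k → ℝ), 0 ≤ ∑ i, ∑ j, c i * c j * C (z i) (z j)) :
    ∃ (Ω : Type) (_ : MeasurableSpace Ω) (P : Measure Ω) (X : T → Ω → ℝ),
      IsProbabilityMeasure P ∧ IsGaussianProcess X P ∧ (∀ z, ∫ ω, X z ω ∂P = 0) ∧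
      ∀ z w, ∫ ω, X z ω * X w ω ∂P = C z w := by
  obtain ⟨E, _, _, _, φ, hφ⟩ := exists_gram_of_posSemidef C hsymm hpos
  obtain ⟨w, b, -⟩ := exists_hilbertBasis ℝ E
  refine ⟨w → ℝ, inferInstance, stdGaussianFamily w, fun z => b.isonormal (φ z), inferInstance,
    b.isGaussianProcess_isonormal φ, fun z => b.integral_isonormal (φ z), fun z z' => ?_⟩
  rw [b.integral_isonormal_mul, hφ]

end Existence

end

/-! ### Convergence of the finite-dimensional distributions -/

section FiniteDimensional

variable {d k : ℕ} {K : Set (EuclideanSpace ℝ (Fin d))} {Ω : Type*} [MeasurableSpace Ω]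
  {N : Ω → Measure (EuclideanSpace ℝ (Fin d) × Ioi (0 : ℝ))} {P : Measure Ω} {H : ℝ}

/-- Presents a single kernel as a simple function, so that the results on Poisson integrals of
simple functions apply to it. -/
theorem coe_kernelCombination_one (hKc : IsCompact K) (z : EuclideanSpace ℝ (Fin d)) :
    (kernelCombination (k := 1) hKc (fun _ => z) fun _ => 1) = fieldKernel K z := by
  ext q
  simp [kernelCombination_apply]

theorem ae_integrable_fieldKernel (hKc : IsCompact K) (hc : Convex ℝ K)
    (hK : (interior K).Nonempty) (hH : H ∈ Ioo (0 : ℝ) (1 / 2))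
    (hN : IsPoissonProcess N (intensity d H) P) (z : EuclideanSpace ℝ (Fin d)) :
    ∀ᵐ ω ∂P, Integrable (fieldKernel K z) (N ω) := by
  have h := hN.ae_integrable _ (integrable_kernelCombination (k := 1) (fun _ => z) (fun _ => 1)
    hKc hc hK hH)
  rwa [coe_kernelCombination_one] at h

theorem aemeasurable_poissonField (hKc : IsCompact K) (hc : Convex ℝ K)
    (hK : (interior K).Nonempty) (hH : H ∈ Ioo (0 : ℝ) (1 / 2))
    (hN : IsPoissonProcess N (intensity d H) P) (z : EuclideanSpace ℝ (Fin d)) :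
    AEMeasurable (poissonField K N z) P := by
  have h := hN.aemeasurable_integral _ (integrable_kernelCombination (k := 1) (fun _ => z)
    (fun _ => 1) hKc hc hK hH)
  rwa [coe_kernelCombination_one] at h

theorem sum_mul_poissonField_ae_eq (hKc : IsCompact K) (hc : Convex ℝ K)
    (hK : (interior K).Nonempty) (hH : H ∈ Ioo (0 : ℝ) (1 / 2))
    (hN : IsPoissonProcess N (intensity d H) P) (z : Fin k → EuclideanSpace ℝ (Fin d))
    (c : Fin k → ℝ) :
    (fun ω => ∑ j, c j * poissonField K N (z j) ω) =ᵐ[P]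
      fun ω => ∫ q, kernelCombination hKc z c q ∂N ω := by
  filter_upwards [ae_all_iff.2 fun j => ae_integrable_fieldKernel hKc hc hK hH hN (z j)] with ω hω
  simp_rw [kernelCombination_apply]
  rw [integral_finsetSum _ fun j _ => (hω j).const_mul (c j)]
  simp_rw [integral_const_mul]
  rfl

/-- The Cramér–Wold reduction: the joint characteristic function is read off from scalar linear
combinations. -/
theorem charFun_map_toLp {P : Measure Ω} {Y : Fin k → Ω → ℝ} (hY : ∀ j, AEMeasurable (Y j) P)
    (t : EuclideanSpace ℝ (Fin k)) :
    charFun (P.map fun ω => WithLp.toLp 2 fun j => Y j ω) t =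
      charFun (P.map fun ω => ∑ j, t j * Y j ω) 1 := by
  have h1 : AEMeasurable (fun ω => (WithLp.toLp 2 fun j => Y j ω : EuclideanSpace ℝ (Fin k))) P :=
    (WithLp.measurable_toLp 2 _).comp_aemeasurable (aemeasurable_pi_lambda _ hY)
  have h2 : AEMeasurable (fun ω => ∑ j, t j * Y j ω) P :=
    Finset.aemeasurable_fun_sum _ fun j _ => (hY j).const_mul _
  rw [charFun_apply, charFun_apply, integral_map h1 (by fun_prop), integral_map h2 (by fun_prop)]
  simp [PiLp.inner_apply]

theorem charFun_map_poissonField [IsProbabilityMeasure P] (hKc : IsCompact K) (hc : Convex ℝ K)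
    (hK : (interior K).Nonempty) (hH : H ∈ Ioo (0 : ℝ) (1 / 2))
    (hN : IsPoissonProcess N (intensity d H) P) (z : Fin k → EuclideanSpace ℝ (Fin d)) (s : ℝ)
    (t : EuclideanSpace ℝ (Fin k)) :
    charFun (P.map fun ω => WithLp.toLp 2 fun j => s * poissonField K N (z j) ω) t =
      Complex.exp (∫ q, (Complex.exp (s * kernelCombination hKc z t q * Complex.I) - 1)
        ∂intensity d H) := by
  have hg := integrable_kernelCombination z t hKc hc hK hH
  rw [charFun_map_toLp fun j => (aemeasurable_poissonField hKc hc hK hH hN (z j)).const_mul s]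
  have h : (fun ω => ∑ j, t j * (s * poissonField K N (z j) ω)) =ᵐ[P]
      fun ω => s * ∫ q, kernelCombination hKc z t q ∂N ω := by
    filter_upwards [sum_mul_poissonField_ae_eq hKc hc hK hH hN z t] with ω hω
    rw [← hω, Finset.mul_sum]
    exact Finset.sum_congr rfl fun j _ => mul_left_comm _ _ _
  rw [Measure.map_congr h, charFun_map_mul_comp (hN.aemeasurable_integral _ hg), mul_one,
    hN.charFun_integral _ hg]

theorem charFun_map_gaussianProcess {X : EuclideanSpace ℝ (Fin d) → Ω → ℝ}
    (hX : IsGaussianProcess X P) (hX0 : ∀ z, ∫ ω, X z ω ∂P = 0)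
    {C : EuclideanSpace ℝ (Fin d) → EuclideanSpace ℝ (Fin d) → ℝ}
    (hC : ∀ z w, ∫ ω, X z ω * X w ω ∂P = C z w) (z : Fin k → EuclideanSpace ℝ (Fin d))
    (t : EuclideanSpace ℝ (Fin k)) :
    charFun (P.map fun ω => WithLp.toLp 2 fun j => X (z j) ω) t =
      Complex.exp (-(∑ i, ∑ j, t i * t j * C (z i) (z j) : ℝ) / 2) := by
  rw [charFun_map_toLp fun j => hX.aemeasurable (z j)]
  have hL2 : ∀ j, MemLp (X (z j)) 2 P := fun j => (hX.hasGaussianLaw_eval (z j)).memLp_two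
  have hG : HasGaussianLaw (fun ω => ∑ j, t j * X (z j) ω) P :=
    ((hX.comp_right z).smul t).hasGaussianLaw_fun_sum (I := Finset.univ)
  have : IsProbabilityMeasure P := hX.isProbabilityMeasure
  have hmean : ∫ ω, ∑ j, t j * X (z j) ω ∂P = 0 := by
    rw [integral_finsetSum _ fun j _ => ((hL2 j).integrable (by simp)).const_mul _]
    simp [integral_const_mul, hX0]
  have hvar : Var[fun ω => ∑ j, t j * X (z j) ω; P] = ∑ i, ∑ j, t i * t j * C (z i) (z j) := by
    rw [variance_of_integral_eq_zero hG.aemeasurable hmean]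
    have h : ∀ ω, (∑ j, t j * X (z j) ω) ^ 2 =
        ∑ i, ∑ j, t i * t j * (X (z i) ω * X (z j) ω) := fun ω => by
      rw [sq, Finset.sum_mul_sum]
      exact Finset.sum_congr rfl fun i _ => Finset.sum_congr rfl fun j _ => by ring
    have hi : ∀ i j, Integrable (fun ω => t i * t j * (X (z i) ω * X (z j) ω)) P := fun i j =>
      ((hL2 i).integrable_mul (hL2 j)).const_mul _
    simp_rw [h]
    rw [integral_finsetSum _ fun i _ => integrable_finsetSum _ fun j _ => hi i j]
    refine Finset.sum_congr rfl fun i _ => ?_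
    rw [integral_finsetSum _ fun j _ => hi i j]
    simp_rw [integral_const_mul, hC]
  rw [hG.charFun_map_eq]
  simp [hmean, hvar, neg_div]

theorem tendsto_charFun_poissonField (hKc : IsCompact K) (hc : Convex ℝ K)
    (hK : (interior K).Nonempty) {Ω : Ioo (0 : ℝ) (1 / 2) → Type*} [∀ H, MeasurableSpace (Ω H)]
    (P : (H : Ioo (0 : ℝ) (1 / 2)) → Measure (Ω H)) [∀ H, IsProbabilityMeasure (P H)]
    (N : (H : Ioo (0 : ℝ) (1 / 2)) → Ω H → Measure (EuclideanSpace ℝ (Fin d) × Ioi (0 : ℝ)))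
    (hN : ∀ H, IsPoissonProcess (N H) (intensity d H) (P H))
    (z : Fin k → EuclideanSpace ℝ (Fin d)) (t : EuclideanSpace ℝ (Fin k)) :
    Tendsto (fun H : Ioo (0 : ℝ) (1 / 2) => charFun ((P H).map fun ω => WithLp.toLp 2
        fun j => √(1 - 2 * (H : ℝ)) * poissonField K (N H) (z j) ω) t)
      (comap Subtype.val (𝓝[<] (1 / 2 : ℝ)))
      (𝓝 (Complex.exp (-(∑ i, ∑ j, t i * t j * fieldCov K (z i) (z j) : ℝ) / 2))) := by
  simp_rw [fun H : Ioo (0 : ℝ) (1 / 2) => charFun_map_poissonField hKc hc hK H.2 (hN H) z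
    (√(1 - 2 * (H : ℝ))) t]
  refine tendsto_exp_integral_exp_sub_one (kernelCombination hKc z t)
    (fun H => integrable_kernelCombination z t hKc hc hK H.2)
    (fun H => integral_kernelCombination z t hKc hc hK H.2) ?_ ?_
  · have hcont : Continuous fun H : ℝ => √(1 - 2 * H) := by fun_prop
    have h := (hcont.tendsto (1 / 2)).mono_left (nhdsWithin_le_nhds (s := Iio (1 / 2)))
    norm_num at h
    have h' : Tendsto (fun H : ℝ => √(1 - 2 * H)) (𝓝[<] (1 / 2)) (𝓝 0) := by
      simpa using h
    exact h'.comp tendsto_comap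
  · refine ((tendsto_integral_sq_kernelCombination z t hKc hc hK).comp tendsto_comap).congr
      fun H => ?_
    rw [Function.comp_apply, Real.sq_sqrt (by linarith [H.2.2])]

theorem tendstoInDistribution_poissonField (hKc : IsCompact K) (hc : Convex ℝ K)
    (hK : (interior K).Nonempty) {Ω : Ioo (0 : ℝ) (1 / 2) → Type*} [∀ H, MeasurableSpace (Ω H)]
    (P : (H : Ioo (0 : ℝ) (1 / 2)) → Measure (Ω H)) [∀ H, IsProbabilityMeasure (P H)]
    (N : (H : Ioo (0 : ℝ) (1 / 2)) → Ω H → Measure (EuclideanSpace ℝ (Fin d) × Ioi (0 : ℝ)))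
    (hN : ∀ H, IsPoissonProcess (N H) (intensity d H) (P H))
    {Ω' : Type*} [MeasurableSpace Ω'] (P' : Measure Ω') [IsProbabilityMeasure P']
    {X : EuclideanSpace ℝ (Fin d) → Ω' → ℝ} (hX : IsGaussianProcess X P')
    (hX0 : ∀ z, ∫ ω, X z ω ∂P' = 0) (hXC : ∀ z w, ∫ ω, X z ω * X w ω ∂P' = fieldCov K z w)
    (z : Fin k → EuclideanSpace ℝ (Fin d)) :
    TendstoInDistribution
      (fun (H : Ioo (0 : ℝ) (1 / 2)) (ω : Ω H) (j : Fin k) =>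
        √(1 - 2 * (H : ℝ)) * poissonField K (N H) (z j) ω)
      (comap Subtype.val (𝓝[<] (1 / 2 : ℝ))) (fun ω (j : Fin k) => X (z j) ω) P P' := by
  -- Characteristic functions require the inner product of `EuclideanSpace`; the result returns to
  -- the plain product by the continuous map `ofLp`.
  have h : TendstoInDistribution
      (fun (H : Ioo (0 : ℝ) (1 / 2)) (ω : Ω H) => (WithLp.toLp 2 fun j : Fin k =>
        √(1 - 2 * (H : ℝ)) * poissonField K (N H) (z j) ω : EuclideanSpace ℝ (Fin k)))
      (comap Subtype.val (𝓝[<] (1 / 2 : ℝ)))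
      (fun ω => WithLp.toLp 2 fun j : Fin k => X (z j) ω) P P' := by
    refine ⟨fun H => (WithLp.measurable_toLp 2 _).comp_aemeasurable (aemeasurable_pi_lambda _
      fun j => (aemeasurable_poissonField hKc hc hK H.2 (hN H) (z j)).const_mul _),
      (WithLp.measurable_toLp 2 _).comp_aemeasurable (aemeasurable_pi_lambda _
        fun j => hX.aemeasurable (z j)), ?_⟩
    -- Lévy's continuity theorem is applied along sequences, which suffices because the filter is
    -- countably generated.
    refine tendsto_of_seq_tendsto fun u hu => ProbabilityMeasure.tendsto_of_tendsto_charFun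
      fun t => ?_
    have h1 := (tendsto_charFun_poissonField hKc hc hK P N hN z t).comp hu
    rw [← charFun_map_gaussianProcess hX hX0 hXC z t] at h1
    exact h1
  exact h.continuous_comp (PiLp.continuous_ofLp 2 _)

end FiniteDimensional

/-- For each `H ∈ (0, 1/2)` let `N H` be a Poisson process on `ℝᵈ × (0, ∞)` with intensity
`dx r^{-d-1+2H} dr`. Then the fields `ξ_{K,H}` generated by `N H` are well defined, the MfBf with
Hurst parameter `1/2` and associated star body `(1/2) Π*K` exists, and the finite-dimensional
distributions of `√(1-2H) ξ_{K,H}` converge to those of this MfBf as `H ↑ 1/2`. -/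
theorem theorem3 {d : ℕ} (hd : 1 ≤ d) (K : ConvexBody (EuclideanSpace ℝ (Fin d)))
    (hK : (interior (K : Set (EuclideanSpace ℝ (Fin d)))).Nonempty)
    {Ω : Ioo (0 : ℝ) (1 / 2) → Type*} [∀ H, MeasurableSpace (Ω H)]
    (P : (H : Ioo (0 : ℝ) (1 / 2)) → Measure (Ω H)) [∀ H, IsProbabilityMeasure (P H)]
    (N : (H : Ioo (0 : ℝ) (1 / 2)) → Ω H → Measure (EuclideanSpace ℝ (Fin d) × Ioi (0 : ℝ)))
    (hN : ∀ H, IsPoissonProcess (N H) (intensity d H) (P H)) :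
    (∀ H z, ∀ᵐ ω ∂(P H), Integrable (fieldKernel (K : Set (EuclideanSpace ℝ (Fin d))) z) (N H ω)) ∧
    (∃ (Ω' : Type) (_ : MeasurableSpace Ω') (P' : Measure Ω')
      (X : EuclideanSpace ℝ (Fin d) → Ω' → ℝ), IsProbabilityMeasure P' ∧
        IsMfBf (1 / 2) ((1 / 2 : ℝ) • polarProjectionBody (K : Set (EuclideanSpace ℝ (Fin d)))) X P') ∧
    ∀ {Ω' : Type*} [MeasurableSpace Ω'] (P' : Measure Ω') [IsProbabilityMeasure P']
      (X : EuclideanSpace ℝ (Fin d) → Ω' → ℝ),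
      IsMfBf (1 / 2) ((1 / 2 : ℝ) • polarProjectionBody (K : Set (EuclideanSpace ℝ (Fin d)))) X P' →
      ∀ (k : ℕ) (z : Fin k → EuclideanSpace ℝ (Fin d)),
        TendstoInDistribution
          (fun (H : Ioo (0 : ℝ) (1 / 2)) (ω : Ω H) (j : Fin k) =>
            √(1 - 2 * (H : ℝ)) * poissonField (K : Set (EuclideanSpace ℝ (Fin d))) (N H) (z j) ω)
          (comap Subtype.val (𝓝[<] (1 / 2 : ℝ)))
          (fun ω (j : Fin k) => X (z j) ω) P P' := by
  have hKc : IsCompact (K : Set (EuclideanSpace ℝ (Fin d))) := K.isCompact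
  have hc : Convex ℝ (K : Set (EuclideanSpace ℝ (Fin d))) := K.convex
  -- At Hurst parameter 1/2 the exponent is 1, and the gauge of the star body is `projNorm K`.
  have hcov : ∀ z w, (1 / 2 : ℝ) *
      (gauge ((1 / 2 : ℝ) • polarProjectionBody (K : Set (EuclideanSpace ℝ (Fin d)))) z ^
          (2 * (1 / 2 : ℝ)) +
        gauge ((1 / 2 : ℝ) • polarProjectionBody (K : Set (EuclideanSpace ℝ (Fin d)))) w ^
          (2 * (1 / 2 : ℝ)) -
        gauge ((1 / 2 : ℝ) • polarProjectionBody (K : Set (EuclideanSpace ℝ (Fin d)))) (z - w) ^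
          (2 * (1 / 2 : ℝ))) = fieldCov K z w := fun z w => by
    simp_rw [gauge_half_smul_polarProjectionBody hKc hc hK]
    norm_num [fieldCov]
  refine ⟨fun H z => ae_integrable_fieldKernel hKc hc hK H.2 (hN H) z, ?_, ?_⟩
  · obtain ⟨Ω', mΩ', P', X, hP', hX, hX0, hXC⟩ := exists_isGaussianProcess_of_posSemidef
      (fieldCov (K : Set (EuclideanSpace ℝ (Fin d)))) (fieldCov_comm hKc hc hK)
      fun k z c => sum_mul_fieldCov_nonneg z c hKc hc hK
    exact ⟨Ω', mΩ', P', X, hP', by norm_num, isStarBody_half_smul_polarProjectionBody hKc hc hK,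
      hX, hX0, fun z w => (hXC z w).trans (hcov z w).symm⟩
  · intro Ω' _ P' _ X hX k z
    exact tendstoInDistribution_poissonField hKc hc hK P N hN P' hX.isGaussian hX.centred
      (fun z w => (hX.covariance z w).trans (hcov z w)) z
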